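/- **Setting.** There are $J$ zones, assigned to $R$ study regions by $j\mapsto r(j)$; the number $K\ge 1$ of folds is fixed. At stage $m=1,2,\dots$ zone $j$ has $n_j=n_j(m)$ labeled fields $(Y_{ji},V_{ji},X_{ji})$, $i\le n_j$, and $N_j=N_j(m)$ unlabeled fields $(V_{ji},X_{ji})$, $n_j<i\le n_j+N_j$; here $Y_{ji}\in\mathbb R$ is a yield, $V_{ji}$ a photo (an element of a measurable space) and $X_{ji}\in\mathbb R^p$ a covariate vector. The estimator is computed as follows. 1. *Cross-fitting.* The labeled fields of each zone are split into $K$ folds whose sizes differ by at most one. For each $k$ a photo model $\hat g^{(-k)}$ is trained, by any measurable and possibly randomized procedure, on the labeled fields of all zones outside fold $k$. Put $\hat Y_{ji}=\hat g^{(-k)}(V_{ji})$ for a labeled field in fold $k$, and $\hat Y_{ji}=\frac1K\sum_k\hat g^{(-k)}(V_{ji})$ for an unlabeled field. The split and the training may use auxiliary randomness that is independent of all data. 2. *Control function.* For each region $r$, $\hat\beta_r\in\mathbb R^{p+2}$ is a LASSO coefficient vector (with unpenalized intercept, with or without standardization of the features) for predicting $Y_{ji}$ from $(1,\hat Y_{ji},X_{ji})$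 on all labeled fields of the region, with any nonnegative, possibly random and data-dependent penalty level (for instance chosen by 5-fold cross-validation). Put $f_{ji}=(1,\hat Y_{ji},X_{ji})\hat\beta_{r(j)}$. 3. *PPI++.* For each zone put $$\hat\lambda_j=\frac{N_j}{n_j+N_j}\cdot\frac{\frac1{n_j-1}\sum_{i\le n_j}(Y_{ji}-\bar Y_j)(f_{ji}-\bar f_{n,j})}{\frac1{n_j+N_j-1}\sum_{i\le n_j+N_j}(f_{ji}-\bar f_j)^2},\qquad \hat\theta_{\mathrm{PPI++},j}=\bar Y_j-\hat\lambda_j\Big(\bar f_{n,j}-\frac1{N_j}\sum_{i=n_j+1}^{n_j+N_j}f_{ji}\Big),$$ where $\bar Y_j,\bar f_{n,j}$ are the averages over the $n_j$ labeled fields and $\bar f_j$ is the average over all $n_j+N_j$ fields of zone $j$. **Assumptions.** At each stage, for every zone $j$, the labeled fields are i.i.d. with a law $P_j$ that does not depend on the stage, and the unlabeled fields are i.i.d. with the law of $(V,X)$ under $P_j$; labeled fields of different zones are independent, and all labeled fields are jointly independent of all unlabeled fields. As $m\to\infty$, $N_j\to\infty$ and $n_j/N_j\to\rho_j\in(0,\infty)$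 for every $j$. Under every $P_j$, $\mathbb E[Y^2]<\infty$ and $\mathbb E\|X\|_2^2<\infty$. There is a measurable $g$ with $\mathbb E_{P_j}[g(V)^2]<\infty$ such that for all $j,k$ the mean squared error $\int(\hat g^{(-k)}(v)-g(v))^2\,dP_j$, a random variable through $\hat g^{(-k)}$, converges to $0$ in probability (this holds in particular if its expectation tends to $0$). Finally $\hat\beta_{r(j)}\to\beta_{r(j)}$ in probability for every $j$, where $\beta_{r(j)}$ is nonrandom. **Theorem.** Let $\theta_j=\mathbb E_{P_j}[Y]$ and $f_j^*=(1,g(V),X)\beta_{r(j)}$. For every zone $j$ with $\mathrm{Var}_{P_j}(f_j^*)>0$ put $$\lambda_j=\frac{\mathrm{cov}_{P_j}(Y,f_j^*)}{(1+\rho_j)\mathrm{Var}_{P_j}(f_j^*)},\qquad V_j=\rho_j\lambda_j^2\,\mathrm{Var}_{P_j}(f_j^*)+\mathrm{Var}_{P_j}(Y-\lambda_jf_j^*).$$ Then, as $m\to\infty$, $$\sqrt{n_j}\,(\hat\theta_{\mathrm{PPI++},j}-\theta_j)\xrightarrow{d}\mathcal N(0,V_j),\qquad \hat\lambda_j\xrightarrow{p}\lambda_j,$$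 and $\hat\theta_{\mathrm{PPI++},j}$ is asymptotically equivalent to the oracle estimator $$\hat\theta^*_{\mathrm{PPI++},j}=\bar Y_j-\lambda_j\Big(\frac1{n_j}\sum_{i\le n_j}f_j^*(V_{ji},X_{ji})-\frac1{N_j}\sum_{i=n_j+1}^{n_j+N_j}f_j^*(V_{ji},X_{ji})\Big),$$ that is, $\sqrt{n_j}\,(\hat\theta_{\mathrm{PPI++},j}-\hat\theta^*_{\mathrm{PPI++},j})\to0$ in probability. -/

import Mathlib

open MeasureTheory ProbabilityTheory Filter Topology

namespace PPI

/-- A labeled field `(Y, V, X)`: ground truth yield, photo, covariate vector in `ℝ^p`. -/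
abbrev Labeled (𝒱 : Type*) (p : ℕ) := ℝ × 𝒱 × EuclideanSpace ℝ (Fin p)

/-- An unlabeled field `(V, X)`. -/
abbrev Unlabeled (𝒱 : Type*) (p : ℕ) := 𝒱 × EuclideanSpace ℝ (Fin p)

/-- Coefficient and feature vectors `(constant, photo prediction, covariates)`. -/
abbrev Coef (p : ℕ) := EuclideanSpace ℝ (Fin (p + 2))

noncomputable section

/-! ### The PPI++ estimator

The control function enters only through its values `fL` on the labeled fields and `fU` on the
unlabeled fields; `y` are the labels. -/

/-- `n⁻¹ ∑ aᵢ`. -/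
def sampleMean {n : ℕ} (a : Fin n → ℝ) : ℝ := (∑ i, a i) / (n : ℝ)

/-- Mean over the labeled and the unlabeled fields together. -/
def pooledMean {n N : ℕ} (fL : Fin n → ℝ) (fU : Fin N → ℝ) : ℝ :=
  ((∑ i, fL i) + ∑ i, fU i) / ((n : ℝ) + (N : ℝ))

/-- Sample covariance of labels and control function over the labeled fields. -/
def sampleCov {n : ℕ} (y fL : Fin n → ℝ) : ℝ :=
  (∑ i, (y i - sampleMean y) * (fL i - sampleMean fL)) / ((n : ℝ) - 1)

/-- Sample variance of the control function over all fields. -/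
def pooledVar {n N : ℕ} (fL : Fin n → ℝ) (fU : Fin N → ℝ) : ℝ :=
  ((∑ i, (fL i - pooledMean fL fU) ^ 2) + ∑ i, (fU i - pooledMean fL fU) ^ 2) /
    ((n : ℝ) + (N : ℝ) - 1)

/-- The data-driven PPI++ coefficient. -/
def lambdaHat {n N : ℕ} (y fL : Fin n → ℝ) (fU : Fin N → ℝ) : ℝ :=
  (N : ℝ) / ((n : ℝ) + (N : ℝ)) * (sampleCov y fL / pooledVar fL fU)

/-- `mean(y) - l * (mean(fL) - mean(fU))`: the estimator with a given coefficient `l`. -/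
def ppiWith {n N : ℕ} (l : ℝ) (y fL : Fin n → ℝ) (fU : Fin N → ℝ) : ℝ :=
  sampleMean y - l * (sampleMean fL - sampleMean fU)

/-- The PPI++ estimator. -/
def ppiPlusPlus {n N : ℕ} (y fL : Fin n → ℝ) (fU : Fin N → ℝ) : ℝ :=
  ppiWith (lambdaHat y fL fU) y fL fU

/-! ### Linear control functions and the LASSO -/

/-- The feature vector `(1, ŷ, x)`. -/
def feature {p : ℕ} (yhat : ℝ) (x : EuclideanSpace ℝ (Fin p)) : Coef p :=
  WithLp.toLp 2 (Matrix.vecCons 1 (Matrix.vecCons yhat fun c => x c))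

/-- `bᵀ z`. -/
def linPred {p : ℕ} (b z : Coef p) : ℝ := ∑ c, b c * z c

/-- Empirical standard deviation of coordinate `c` of the features `z`. -/
def featureSD {ι : Type*} [Fintype ι] {p : ℕ} (z : ι → Coef p) (c : Fin (p + 2)) : ℝ :=
  √((∑ i, (z i c - (∑ i', z i' c) / (Fintype.card ι : ℝ)) ^ 2) / (Fintype.card ι : ℝ))

/-- The LASSO objective with penalty level `μ` and unpenalized intercept (coordinate `0`).
If `std` is true, coordinates are penalized on the scale of standardized features. -/
def lassoObjective {ι : Type*} [Fintype ι] {p : ℕ} (std : Bool) (μ : ℝ)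
    (y : ι → ℝ) (z : ι → Coef p) (b : Coef p) : ℝ :=
  (∑ i, (y i - linPred b (z i)) ^ 2) / (2 * (Fintype.card ι : ℝ)) +
    μ * ∑ c : Fin (p + 1), (if std then featureSD z c.succ else 1) * |b c.succ|

/-- `b` is a LASSO coefficient vector with penalty level `μ`. -/
def IsLasso {ι : Type*} [Fintype ι] {p : ℕ} (std : Bool) (μ : ℝ)
    (y : ι → ℝ) (z : ι → Coef p) (b : Coef p) : Prop :=
  IsMinOn (lassoObjective std μ y z) Set.univ b

/-! ### The full procedure -/

/-- The random inputs and the tuning choices of one run of the full procedure, with `J` zones,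
`R` study regions and `K` cross-fitting folds. The auxiliary random element `aux` carries the
randomness of the fold assignment and of the training algorithm. -/
structure Run (J R K p : ℕ) (𝒱 𝒰 Ω : Type*) where
  /-- number of labeled fields in each zone -/
  n : Fin J → ℕ
  /-- number of unlabeled fields in each zone -/
  N : Fin J → ℕ
  /-- the labeled fields -/
  lab : (j : Fin J) → Fin (n j) → Ω → Labeled 𝒱 p
  /-- the unlabeled fields -/
  unl : (j : Fin J) → Fin (N j) → Ω → Unlabeled 𝒱 p
  /-- auxiliary randomness -/
  aux : Ω → 𝒰
  /-- assignment of the labeled fields to folds -/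
  fold : 𝒰 → (j : Fin J) → Fin (n j) → Fin K
  /-- `train k u d` is the photo model produced for fold `k` from the labeled data `d` -/
  train : Fin K → 𝒰 → ((j : Fin J) → Fin (n j) → Labeled 𝒱 p) → 𝒱 → ℝ
  /-- study region of each zone -/
  region : Fin J → Fin R
  /-- whether the LASSO standardizes the features -/
  std : Bool
  /-- LASSO penalty levels, which may depend on the data (for instance by cross-validation) -/
  penalty : Fin R → Ω → ℝ
  /-- the fitted coefficients of each study region -/
  betaHat : Fin R → Ω → Coef p

namespace Run

variable {J R K p : ℕ} {𝒱 𝒰 Ω : Type*} (S : Run J R K p 𝒱 𝒰 Ω)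

/-- All labeled data. -/
def labData (ω : Ω) : (j : Fin J) → Fin (S.n j) → Labeled 𝒱 p := fun j i => S.lab j i ω

/-- All unlabeled data. -/
def unlData (ω : Ω) : (j : Fin J) → Fin (S.N j) → Unlabeled 𝒱 p := fun j i => S.unl j i ω

/-- The photo model of fold `k`. -/
def ghat (k : Fin K) (ω : Ω) : 𝒱 → ℝ := S.train k (S.aux ω) (S.labData ω)

/-- Labels in zone `j`. -/
def y (j : Fin J) (ω : Ω) (i : Fin (S.n j)) : ℝ := (S.lab j i ω).1

/-- Photo prediction on a labeled field: the model of its own fold. -/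
def yhatLab (j : Fin J) (ω : Ω) (i : Fin (S.n j)) : ℝ :=
  S.ghat (S.fold (S.aux ω) j i) ω (S.lab j i ω).2.1

/-- Photo prediction on an unlabeled field: the average of the `K` models. -/
def yhatUnl (j : Fin J) (ω : Ω) (i : Fin (S.N j)) : ℝ :=
  (∑ k, S.ghat k ω (S.unl j i ω).1) / (K : ℝ)

/-- Features of a labeled field. -/
def featLab (j : Fin J) (ω : Ω) (i : Fin (S.n j)) : Coef p :=
  feature (S.yhatLab j ω i) (S.lab j i ω).2.2

/-- Features of an unlabeled field. -/
def featUnl (j : Fin J) (ω : Ω) (i : Fin (S.N j)) : Coef p :=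
  feature (S.yhatUnl j ω i) (S.unl j i ω).2

/-- The learned control function on the labeled fields of zone `j`. -/
def fLab (j : Fin J) (ω : Ω) (i : Fin (S.n j)) : ℝ :=
  linPred (S.betaHat (S.region j) ω) (S.featLab j ω i)

/-- The learned control function on the unlabeled fields of zone `j`. -/
def fUnl (j : Fin J) (ω : Ω) (i : Fin (S.N j)) : ℝ :=
  linPred (S.betaHat (S.region j) ω) (S.featUnl j ω i)

/-- The coefficient `λ̂ⱼ` of zone `j`. -/
def lambda (j : Fin J) (ω : Ω) : ℝ := lambdaHat (S.y j ω) (S.fLab j ω) (S.fUnl j ω)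

/-- The PPI++ estimate of zone `j`. -/
def estimate (j : Fin J) (ω : Ω) : ℝ := ppiPlusPlus (S.y j ω) (S.fLab j ω) (S.fUnl j ω)

/-- The oracle estimate of zone `j`, with a fixed control function `f` and coefficient `l`. -/
def oracle (f : Unlabeled 𝒱 p → ℝ) (l : ℝ) (j : Fin J) (ω : Ω) : ℝ :=
  ppiWith l (S.y j ω) (fun i => f (S.lab j i ω).2) (fun i => f (S.unl j i ω))

/-- The labeled fields whose zone lies in region `r`. -/
abbrev RegionIndex (r : Fin R) := {a : Σ j : Fin J, Fin (S.n j) // S.region a.1 = r}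

/-- The rules that a run of the procedure obeys. -/
structure IsValid [MeasurableSpace 𝒱] [MeasurableSpace 𝒰] [MeasurableSpace Ω] : Prop where
  measurable_fold : ∀ j i, Measurable fun u => S.fold u j i
  /-- the folds of each zone are as even as possible -/
  fold_even : ∀ u j k k', (Finset.univ.filter fun i => S.fold u j i = k).card ≤
    (Finset.univ.filter fun i => S.fold u j i = k').card + 1
  measurable_train : ∀ k, Measurable fun q : 𝒰 × ((j : Fin J) → Fin (S.n j) → Labeled 𝒱 p) × 𝒱 =>
    S.train k q.1 q.2.1 q.2.2
  /-- the model of fold `k` uses only the labeled fields outside fold `k` -/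
  train_outside_fold : ∀ k u d d', (∀ j i, S.fold u j i ≠ k → d j i = d' j i) →
    S.train k u d = S.train k u d'
  measurable_betaHat : ∀ r, Measurable (S.betaHat r)
  penalty_nonneg : ∀ r ω, 0 ≤ S.penalty r ω
  /-- regional coefficients are LASSO fits on all labeled fields of the region -/
  lasso : ∀ r ω, IsLasso S.std (S.penalty r ω)
    (fun a : S.RegionIndex r => S.y a.1.1 ω a.1.2)
    (fun a : S.RegionIndex r => S.featLab a.1.1 ω a.1.2) (S.betaHat r ω)

/-- The sampling assumptions: in zone `j` the labeled fields are i.i.d. with law `P j`, the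
unlabeled ones are i.i.d. with the corresponding law of `(V, X)`, the labeled fields are independent
across zones, they are independent of the unlabeled fields, and the auxiliary randomness is
independent of all data. -/
structure IsSample [MeasurableSpace 𝒱] [MeasurableSpace 𝒰] [MeasurableSpace Ω]
    (P : Fin J → Measure (Labeled 𝒱 p)) (Pr : Measure Ω) : Prop where
  measurable_lab : ∀ j i, Measurable (S.lab j i)
  measurable_unl : ∀ j i, Measurable (S.unl j i)
  measurable_aux : Measurable S.aux
  law_lab : ∀ j i, Pr.map (S.lab j i) = P j
  law_unl : ∀ j i, Pr.map (S.unl j i) = (P j).map Prod.snd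
  indep_lab : iIndepFun (fun (a : Σ j : Fin J, Fin (S.n j)) => S.lab a.1 a.2) Pr
  indep_unl : ∀ j, iIndepFun (fun i : Fin (S.N j) => S.unl j i) Pr
  indep_lab_unl : IndepFun S.labData S.unlData Pr
  indep_aux : IndepFun S.aux (fun ω => (S.labData ω, S.unlData ω)) Pr

end Run

/-! ### Limiting quantities, in terms of the law `P` of a labeled field -/

/-- The limiting control function `f*(v, x) = (1, g(v), x) β`. -/
def fStar {𝒱 : Type*} {p : ℕ} (g : 𝒱 → ℝ) (β : Coef p) (w : Unlabeled 𝒱 p) : ℝ :=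
  linPred β (feature (g w.1) w.2)

variable {𝒱 : Type*} {p : ℕ} [MeasurableSpace 𝒱]

/-- `θ = E[Y]`. -/
def theta (P : Measure (Labeled 𝒱 p)) : ℝ := ∫ z, z.1 ∂P

/-- `Var(f(V, X))`. -/
def varControl (P : Measure (Labeled 𝒱 p)) (f : Unlabeled 𝒱 p → ℝ) : ℝ :=
  variance (fun z => f z.2) P

/-- `λ = cov(Y, f) / ((1 + ρ) Var f)`. -/
def lambdaStar (P : Measure (Labeled 𝒱 p)) (f : Unlabeled 𝒱 p → ℝ) (ρ : ℝ) : ℝ :=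
  covariance (fun z => z.1) (fun z => f z.2) P / ((1 + ρ) * varControl P f)

/-- `ρ λ² Var f + Var(Y - λ f)`. -/
def asympVar (P : Measure (Labeled 𝒱 p)) (f : Unlabeled 𝒱 p → ℝ) (ρ : ℝ) : ℝ :=
  ρ * lambdaStar P f ρ ^ 2 * varControl P f +
    variance (fun z => z.1 - lambdaStar P f ρ * f z.2) P

end

end PPI

/-! Write f for the limiting control function, f̂ for the learned one, λ for the limiting
coefficient. The oracle is the labeled mean of Y − λf plus λ times the unlabeled mean of f. These
are independent i.i.d. averages and E f cancels from the centering, so the central limit theorem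
gives the variance Var(Y − λf) + ρλ² Var f (`tendstoInDistribution_leading`,
`tendsto_oracle_sub_leading`). By Slutsky it remains to compare PPI++ with the oracle.

Their difference is −λ̂D − (λ̂ − λ)Δ, where Δ is the labeled minus the unlabeled mean of f and D is
the same contrast for f̂ − f (`tendsto_mul_ppiPlusPlus_sub`). Both means in Δ have the same
expectation, so √n Δ is bounded in probability and consistency of λ̂, without any rate, is enough.
Consistency follows from the law of large numbers and from closeness of f̂ to f in empirical mean
square (`tendsto_lambdaHat`).

For √n D → 0, split f̂ − f into (β̂ − β) applied to the limiting features plus a coefficient times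
the prediction error. The first part is a vanishing factor times a bounded contrast
(`tendsto_mul_sampleMean_linPred_sub`). The second is where cross-fitting acts: given the auxiliary
randomness and the data outside fold k, the errors of model k on its own fold and on the unlabeled
fields are independent with a common mean, the bias of that model. After centering, their normalized
sums have second moment at most the mean squared error. The biases may vanish arbitrarily slowly;
they cancel because each fold has share 1/K up to 1/n, and 1/K is the weight of each model on the
unlabeled fields (`tendsto_sqrt_mul_sampleMean_error_sub`).

The mean squared error converges only in probability, so moments of the errors need not exist.
Errors are therefore set to zero when it exceeds c (`truncError`), which changes nothing with
probability tending to one. Convergence in probability is expressed as convergence along the filter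
`inProb`, so that ordinary limit algebra applies. -/

namespace PPI

/-! ### Convergence in probability as convergence along a filter -/

section InProb

variable {Ω : Type*} [MeasurableSpace Ω] {Pr : Measure Ω}

/-- The filter of those sets of pairs `(m, ω)` whose `m`-th section has probability tending to one
as `m → ∞`. Convergence in probability to a constant is convergence along this filter. -/
def inProb (Pr : Measure Ω) : Filter (ℕ × Ω) where
  sets := {A | Tendsto (fun m => Pr {ω | (m, ω) ∉ A}) atTop (𝓝 0)}
  univ_sets := by simp
  sets_of_superset := fun {A B} hA hAB =>
    tendsto_of_tendsto_of_tendsto_of_le_of_le tendsto_const_nhds hA (fun _ => zero_le)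
      (fun m => measure_mono fun ω hω h => hω (hAB h))
  inter_sets := fun {A B} hA hB => by
    have h := Tendsto.add hA hB
    rw [add_zero] at h
    refine tendsto_of_tendsto_of_tendsto_of_le_of_le tendsto_const_nhds h (fun _ => zero_le)
      (fun m => (measure_mono fun ω hω => ?_).trans (measure_union_le _ _))
    by_contra hc
    simp only [Set.mem_union, Set.mem_ofPred_eq, not_or, not_not] at hc
    exact hω ⟨hc.1, hc.2⟩

lemma eventually_inProb {p : ℕ × Ω → Prop} :
    (∀ᶠ q in inProb Pr, p q) ↔ Tendsto (fun m => Pr {ω | ¬ p (m, ω)}) atTop (𝓝 0) := Iff.rfl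

lemma tendsto_fst_inProb : Tendsto Prod.fst (inProb Pr) atTop := by
  intro A hA
  change Tendsto (fun m => Pr {ω | (m, ω) ∉ Prod.fst ⁻¹' A}) atTop (𝓝 0)
  refine tendsto_const_nhds.congr' ?_
  filter_upwards [hA] with m hm
  simp [hm]

/-- The bridge that turns sums, products, quotients and squeezing of limits in probability into the
corresponding facts about filters, with no measurability conditions. -/
lemma tendstoInMeasure_const_iff {E : Type*} [PseudoMetricSpace E] {X : ℕ → Ω → E} {c : E} :
    TendstoInMeasure Pr X atTop (fun _ => c) ↔
      Tendsto (fun q : ℕ × Ω => X q.1 q.2) (inProb Pr) (𝓝 c) := by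
  rw [tendstoInMeasure_iff_dist, Metric.tendsto_nhds]
  simp_rw [eventually_inProb, not_lt]

/-- Second moment bound. -/
def SqMomentLe (Pr : Measure Ω) (X : Ω → ℝ) (c : ℝ) : Prop :=
  MemLp X 2 Pr ∧ ∫ ω, X ω ^ 2 ∂Pr ≤ c

lemma SqMomentLe.const_mul {X : Ω → ℝ} {c : ℝ} (h : SqMomentLe Pr X c) (a : ℝ) :
    SqMomentLe Pr (fun ω => a * X ω) (a ^ 2 * c) := by
  refine ⟨h.1.const_mul a, ?_⟩
  simp_rw [mul_pow, integral_const_mul]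
  exact mul_le_mul_of_nonneg_left h.2 (sq_nonneg a)

lemma SqMomentLe.mono {X : Ω → ℝ} {c d : ℝ} (h : SqMomentLe Pr X c) (hcd : c ≤ d) :
    SqMomentLe Pr X d := ⟨h.1, h.2.trans hcd⟩

lemma sqMomentLe_of_lintegral {X : Ω → ℝ} {c : ℝ} (hc : 0 ≤ c)
    (hX : AEStronglyMeasurable X Pr) (h : ∫⁻ ω, ‖X ω‖ₑ ^ 2 ∂Pr ≤ ENNReal.ofReal c) :
    SqMomentLe Pr X c := by
  have h2 : ∫⁻ ω, ENNReal.ofReal (X ω ^ 2) ∂Pr ≤ ENNReal.ofReal c := by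
    refine le_trans (le_of_eq (lintegral_congr fun ω => ?_)) h
    rw [← sq_abs, ENNReal.ofReal_pow (abs_nonneg _), ← Real.norm_eq_abs, ofReal_norm]
  refine ⟨⟨hX, ?_⟩, ?_⟩
  · rw [eLpNorm_lt_top_iff_lintegral_rpow_enorm_lt_top (by norm_num) (by norm_num)]
    refine lt_of_le_of_lt ?_ (lt_of_le_of_lt h ENNReal.ofReal_lt_top)
    refine lintegral_mono fun ω => ?_
    simp
  · rw [integral_eq_lintegral_of_nonneg_ae (ae_of_all _ fun _ => sq_nonneg _) (hX.pow 2)]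
    exact ENNReal.toReal_le_of_le_ofReal hc h2

/-- Chebyshev's inequality. -/
lemma SqMomentLe.measure_le {X : Ω → ℝ} {c a : ℝ} (h : SqMomentLe Pr X c) (ha : 0 < a) :
    Pr {ω | a ≤ |X ω|} ≤ ENNReal.ofReal (c / a ^ 2) := by
  have hi := h.1.integrable_sq
  have h1 := mul_meas_ge_le_lintegral₀ (μ := Pr) (f := fun ω => ENNReal.ofReal (X ω ^ 2))
    hi.1.aemeasurable.ennreal_ofReal (ENNReal.ofReal (a ^ 2))
  rw [← ofReal_integral_eq_lintegral_ofReal hi (ae_of_all _ fun _ => sq_nonneg _)] at h1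
  rw [ENNReal.ofReal_div_of_pos (by positivity), ENNReal.le_div_iff_mul_le
    (Or.inl (by simpa using by positivity)) (Or.inl ENNReal.ofReal_ne_top), mul_comm]
  refine le_trans ?_ (h1.trans (ENNReal.ofReal_le_ofReal h.2))
  gcongr with ω
  intro hω
  apply ENNReal.ofReal_le_ofReal
  rw [← sq_abs (X ω)]
  exact pow_le_pow_left₀ ha.le hω 2

/-- A sequence that, with probability tending to one, agrees with sequences of arbitrarily small
second moment converges to zero in probability. -/
lemma tendsto_zero_of_sqMomentLe {X : ℕ → Ω → ℝ}
    (h : ∀ c : ℝ, 0 < c → ∃ X' : ℕ → Ω → ℝ, (∀ᶠ m in atTop, SqMomentLe Pr (X' m) c) ∧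
      ∀ᶠ q in inProb Pr, X q.1 q.2 = X' q.1 q.2) :
    Tendsto (fun q : ℕ × Ω => X q.1 q.2) (inProb Pr) (𝓝 0) := by
  rw [Metric.tendsto_nhds]
  intro a ha
  rw [eventually_inProb, ENNReal.tendsto_nhds_zero]
  intro δ hδ
  -- Half of `δ` is spent on Chebyshev, half on the event of disagreement. Since `δ` may be `⊤`, a
  -- real bound has to be extracted first.
  obtain ⟨e, he0, heδ⟩ : ∃ e : ℝ, 0 < e ∧ ENNReal.ofReal e ≤ δ / 2 := by
    rcases eq_or_ne δ ⊤ with rfl | hT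
    · exact ⟨1, one_pos, by simp [ENNReal.top_div]⟩
    · exact ⟨(δ / 2).toReal, ENNReal.toReal_pos (by simpa using hδ.ne')
        (ENNReal.div_ne_top hT (by norm_num)), ENNReal.ofReal_toReal_le⟩
  -- A second moment of `e * a ^ 2` makes the Chebyshev bound at level `a` equal to `e`.
  obtain ⟨X', hX', hq⟩ := h (e * a ^ 2) (by positivity)
  rw [eventually_inProb, ENNReal.tendsto_nhds_zero] at hq
  filter_upwards [hX', hq (δ / 2) (by simpa using hδ.ne')] with m hm hm'
  have h1 := hm.measure_le ha
  rw [mul_div_cancel_right₀ _ (by positivity)] at h1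
  calc Pr {ω | ¬ dist (X m ω) 0 < a}
      ≤ Pr ({ω | a ≤ |X' m ω|} ∪ {ω | ¬ X m ω = X' m ω}) := by
        refine measure_mono fun ω hω => ?_
        by_cases hx : X m ω = X' m ω
        · left
          simpa [hx] using hω
        · exact Or.inr hx
    _ ≤ _ := measure_union_le _ _
    _ ≤ δ / 2 + δ / 2 := add_le_add (h1.trans heδ) hm'
    _ = δ := ENNReal.add_halves δ

/-- Boundedness in probability, expressed by its effect on sequences tending to zero. -/
def BddAlong {α : Type*} (F : Filter α) (X : α → ℝ) : Prop :=
  ∀ T : α → ℝ, Tendsto T F (𝓝 0) → Tendsto (fun q => T q * X q) F (𝓝 0)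

lemma BddAlong.sub {α : Type*} {F : Filter α} {X Y : α → ℝ} (hX : BddAlong F X)
    (hY : BddAlong F Y) : BddAlong F (fun q => X q - Y q) := fun T hT => by
  simpa [mul_sub] using (hX T hT).sub (hY T hT)

lemma BddAlong.mul_of_tendsto {α : Type*} {F : Filter α} {X Y : α → ℝ} {c : ℝ}
    (hX : BddAlong F X) (hY : Tendsto Y F (𝓝 c)) : BddAlong F (fun q => Y q * X q) :=
  fun T hT => by
  simpa [mul_assoc] using hX (fun q => T q * Y q) (by simpa using hT.mul hY)

/-- Uniform second moments give tightness: outside an event of small probability `|X| < M`, and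
there `|T| < a / M` suffices. -/
lemma bddAlong_of_sqMomentLe {X : ℕ → Ω → ℝ} {C : ℝ}
    (h : ∀ᶠ m in atTop, SqMomentLe Pr (X m) C) :
    BddAlong (inProb Pr) (fun q => X q.1 q.2) := by
  intro T hT
  rw [Metric.tendsto_nhds]
  intro a ha
  rw [eventually_inProb, ENNReal.tendsto_nhds_zero]
  intro δ hδ
  obtain ⟨e, he0, heδ⟩ : ∃ e : ℝ, 0 < e ∧ ENNReal.ofReal e ≤ δ / 2 := by
    rcases eq_or_ne δ ⊤ with rfl | hT
    · exact ⟨1, one_pos, by simp [ENNReal.top_div]⟩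
    · exact ⟨(δ / 2).toReal, ENNReal.toReal_pos (by simpa using hδ.ne')
        (ENNReal.div_ne_top hT (by norm_num)), ENNReal.ofReal_toReal_le⟩
  obtain ⟨M, hM0, hM⟩ : ∃ M : ℝ, 0 < M ∧ C / M ^ 2 ≤ e := by
    -- The absolute value is taken because `C` has no assumed sign; the added one keeps `M`
    -- positive.
    refine ⟨√(|C| / e) + 1, by positivity, ?_⟩
    rw [div_le_iff₀ (by positivity)]
    have h1 : |C| = e * √(|C| / e) ^ 2 := by
      rw [Real.sq_sqrt (by positivity)]; field_simp
    nlinarith [le_abs_self C, Real.sqrt_nonneg (|C| / e)]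
  have hT' := (Metric.tendsto_nhds.1 hT) (a / M) (by positivity)
  rw [eventually_inProb, ENNReal.tendsto_nhds_zero] at hT'
  filter_upwards [h, hT' (δ / 2) (by simpa using hδ.ne')] with m hm hm'
  have h1 := (hm.measure_le hM0).trans (ENNReal.ofReal_le_ofReal hM)
  calc Pr {ω | ¬ dist (T (m, ω) * X m ω) 0 < a}
      ≤ Pr ({ω | M ≤ |X m ω|} ∪ {ω | ¬ dist (T (m, ω)) 0 < a / M}) := by
        refine measure_mono fun ω hω => ?_
        by_contra hx
        simp only [Set.mem_union, Set.mem_ofPred_eq, not_or, not_le, not_not, dist_zero_right,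
          Real.norm_eq_abs] at hx hω
        apply hω
        rw [abs_mul]
        calc |T (m, ω)| * |X m ω| ≤ |T (m, ω)| * M := by gcongr; exact hx.1.le
          _ < a / M * M := by gcongr; exact hx.2
          _ = a := by field_simp
    _ ≤ _ := measure_union_le _ _
    _ ≤ δ / 2 + δ / 2 := add_le_add (h1.trans heδ) hm'
    _ = δ := ENNReal.add_halves δ

end InProb

/-! ### Second moments of orthogonal sums -/

section Orthogonal

variable {Ω 𝒲 𝒵 : Type*} [MeasurableSpace Ω] [MeasurableSpace 𝒲] [MeasurableSpace 𝒵]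
  {Pr : Measure Ω}

/-- Pythagoras: without cross terms the bound grows like the number of summands, not its square.
This is what the √n scaling needs. -/
lemma sqMomentLe_sum {ι : Type*} [Fintype ι] {H : ι → Ω → ℝ} {c : ℝ}
    (hH : ∀ i, SqMomentLe Pr (H i) c) (ho : ∀ i i', i ≠ i' → ∫ ω, H i ω * H i' ω ∂Pr = 0) :
    SqMomentLe Pr (fun ω => ∑ i, H i ω) (Fintype.card ι * c) := by
  classical
  refine ⟨memLp_finsetSum _ fun i _ => (hH i).1, ?_⟩
  have hi : ∀ i i', Integrable (fun ω => H i ω * H i' ω) Pr :=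
    fun i i' => (hH i).1.integrable_mul (hH i').1
  calc ∫ ω, (∑ i, H i ω) ^ 2 ∂Pr = ∫ ω, ∑ i, ∑ i', H i ω * H i' ω ∂Pr := by
        simp_rw [sq, Finset.sum_mul_sum]
    _ = ∑ i, ∑ i', ∫ ω, H i ω * H i' ω ∂Pr := by
        rw [integral_finsetSum _ fun i _ => integrable_finsetSum _ fun i' _ => hi i i']
        exact Finset.sum_congr rfl fun i _ => integral_finsetSum _ fun i' _ => hi i i'
    _ = ∑ i, ∫ ω, H i ω ^ 2 ∂Pr := by
        refine Finset.sum_congr rfl fun i _ => ?_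
        rw [Finset.sum_eq_single i (fun i' _ hne => ho i i' hne.symm) (by simp)]
        simp_rw [sq]
    _ ≤ ∑ _i : ι, c := Finset.sum_le_sum fun i _ => (hH i).2
    _ = _ := by simp

/-- Conditioning on `W` in the form of Fubini for the product law. In the applications `W` is the
training data and `Z` a fresh field. -/
lemma integral_comp_eq_zero_of_indepFun [IsProbabilityMeasure Pr] {W : Ω → 𝒲} {Z : Ω → 𝒵}
    {Q : Measure 𝒵} (hW : Measurable W) (hZ : Measurable Z) (hQ : Pr.map Z = Q)
    (hind : IndepFun W Z Pr) {φ : 𝒲 → 𝒵 → ℝ}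
    (hφ : Measurable (Function.uncurry φ)) (h0 : ∀ w, ∫ z, φ w z ∂Q = 0) :
    ∫ ω, φ (W ω) (Z ω) ∂Pr = 0 := by
  subst hQ
  have : IsProbabilityMeasure (Pr.map Z) := Measure.isProbabilityMeasure_map hZ.aemeasurable
  have : IsProbabilityMeasure (Pr.map W) := Measure.isProbabilityMeasure_map hW.aemeasurable
  have h1 : ∫ ω, φ (W ω) (Z ω) ∂Pr
      = ∫ q, Function.uncurry φ q ∂((Pr.map W).prod (Pr.map Z)) := by
    rw [← (indepFun_iff_map_prod_eq_prod_map_map hW.aemeasurable hZ.aemeasurable).1 hind,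
      integral_map (hW.prodMk hZ).aemeasurable hφ.aestronglyMeasurable]
    rfl
  rw [h1]
  -- Integrability need not be assumed: without it the Bochner integral is zero by convention.
  by_cases hint : Integrable (Function.uncurry φ) ((Pr.map W).prod (Pr.map Z))
  · rw [integral_prod _ hint]
    simp [Function.uncurry, h0]
  · exact integral_undef hint

/-- Tonelli for the product law: a bound that holds for each frozen value of `W` survives averaging
over `W`. -/
lemma sqMomentLe_comp_of_indepFun [IsProbabilityMeasure Pr] {W : Ω → 𝒲} {Z : Ω → 𝒵}
    {Q : Measure 𝒵} (hW : Measurable W) (hZ : Measurable Z) (hQ : Pr.map Z = Q)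
    (hind : IndepFun W Z Pr) {φ : 𝒲 → 𝒵 → ℝ} (hφ : Measurable (Function.uncurry φ)) {c : ℝ}
    (hc : 0 ≤ c) (h : ∀ w, ∫⁻ z, ‖φ w z‖ₑ ^ 2 ∂Q ≤ ENNReal.ofReal c) :
    SqMomentLe Pr (fun ω => φ (W ω) (Z ω)) c := by
  subst hQ
  have : IsProbabilityMeasure (Pr.map Z) := Measure.isProbabilityMeasure_map hZ.aemeasurable
  have : IsProbabilityMeasure (Pr.map W) := Measure.isProbabilityMeasure_map hW.aemeasurable
  refine sqMomentLe_of_lintegral hc (hφ.comp (hW.prodMk hZ)).aestronglyMeasurable ?_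
  have hm : Measurable fun q => ‖Function.uncurry φ q‖ₑ ^ 2 := by fun_prop
  have h1 : ∫⁻ ω, ‖φ (W ω) (Z ω)‖ₑ ^ 2 ∂Pr
      = ∫⁻ q, ‖Function.uncurry φ q‖ₑ ^ 2 ∂((Pr.map W).prod (Pr.map Z)) := by
    rw [← (indepFun_iff_map_prod_eq_prod_map_map hW.aemeasurable hZ.aemeasurable).1 hind,
      lintegral_map hm (hW.prodMk hZ)]
    rfl
  rw [h1, lintegral_prod _ hm.aemeasurable]
  calc ∫⁻ w, ∫⁻ z, ‖Function.uncurry φ (w, z)‖ₑ ^ 2 ∂(Pr.map Z) ∂(Pr.map W)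
      ≤ ∫⁻ _w, ENNReal.ofReal c ∂(Pr.map W) := lintegral_mono fun w => h w
    _ = ENNReal.ofReal c := by simp

/-- The joint law is the product of three laws, and that product may be bracketed either way. -/
lemma indepFun_prodMk_left {𝒜 : Type*} [MeasurableSpace 𝒜] [IsProbabilityMeasure Pr]
    {A : Ω → 𝒜} {W : Ω → 𝒲} {Z : Ω → 𝒵} (hA : Measurable A) (hW : Measurable W)
    (hZ : Measurable Z) (h1 : IndepFun A (fun ω => (W ω, Z ω)) Pr) (h2 : IndepFun W Z Pr) :
    IndepFun (fun ω => (A ω, W ω)) Z Pr := by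
  have : IsProbabilityMeasure (Pr.map Z) := Measure.isProbabilityMeasure_map hZ.aemeasurable
  have : IsProbabilityMeasure (Pr.map W) := Measure.isProbabilityMeasure_map hW.aemeasurable
  have : IsProbabilityMeasure (Pr.map A) := Measure.isProbabilityMeasure_map hA.aemeasurable
  have h3 : IndepFun A W Pr := h1.comp measurable_id measurable_fst
  rw [indepFun_iff_map_prod_eq_prod_map_map (hA.prodMk hW).aemeasurable hZ.aemeasurable,
    (indepFun_iff_map_prod_eq_prod_map_map hA.aemeasurable hW.aemeasurable).1 h3]
  have e := (indepFun_iff_map_prod_eq_prod_map_map hA.aemeasurable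
    (hW.prodMk hZ).aemeasurable).1 h1
  rw [(indepFun_iff_map_prod_eq_prod_map_map hW.aemeasurable hZ.aemeasurable).1 h2] at e
  rw [← (measurePreserving_prodAssoc (Pr.map A) (Pr.map W) (Pr.map Z)).symm.map_eq, ← e,
    Measure.map_map (MeasurableEquiv.measurable _) (hA.prodMk (hW.prodMk hZ))]
  rfl

/-- Variance is at most the second moment. -/
lemma lintegral_enorm_sub_integral_sq_le {Q : Measure 𝒵} [IsProbabilityMeasure Q] {f : 𝒵 → ℝ}
    {c : ℝ} (hc : 0 ≤ c) (hf : AEStronglyMeasurable f Q)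
    (h : ∫⁻ z, ‖f z‖ₑ ^ 2 ∂Q ≤ ENNReal.ofReal c) :
    ∫⁻ z, ‖f z - ∫ z', f z' ∂Q‖ₑ ^ 2 ∂Q ≤ ENNReal.ofReal c := by
  obtain ⟨hm, hi⟩ := sqMomentLe_of_lintegral hc hf h
  have h1 := ofReal_variance hm
  rw [evariance] at h1
  rw [← h1]
  exact ENNReal.ofReal_le_ofReal ((variance_le_expectation_sq hf).trans hi)

end Orthogonal

/-! ### Limit theorems for triangular arrays with i.i.d. rows of a fixed law -/

section Rows

variable {Ω 𝒵 : Type*} [MeasurableSpace Ω] [MeasurableSpace 𝒵]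
  {Pr : Measure Ω} [IsProbabilityMeasure Pr] {Q : Measure 𝒵} [IsProbabilityMeasure Q]

/-- An i.i.d. row has the law of an initial segment of the canonical i.i.d. sequence. -/
lemma map_row_eq {n : ℕ} {Z : Fin n → Ω → 𝒵} (hZ : ∀ i, Measurable (Z i))
    (hQ : ∀ i, Pr.map (Z i) = Q) (hind : iIndepFun Z Pr) :
    Pr.map (fun ω i => Z i ω) =
      (Measure.infinitePi fun _ : ℕ => Q).map (fun x (i : Fin n) => x i) := by
  rw [(iIndepFun_iff_map_fun_eq_pi_map fun i => (hZ i).aemeasurable).1 hind]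
  have h2 : iIndepFun (fun (i : Fin n) (x : ℕ → 𝒵) => x i)
      (Measure.infinitePi fun _ : ℕ => Q) :=
    (iIndepFun_infinitePi (P := fun _ : ℕ => Q) (X := fun _ z => z)
      (fun _ => measurable_id)).precomp Fin.val_injective
  rw [(iIndepFun_iff_map_fun_eq_pi_map fun i => (measurable_pi_apply _).aemeasurable).1 h2]
  congr 1
  ext1 i
  rw [hQ, Measure.infinitePi_map_eval (fun _ : ℕ => Q)]

/-- Limit laws in probability or in distribution see only the law of each row. Those of one infinite
i.i.d. sequence thus pass to triangular arrays, whatever the dependence between rows. -/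
lemma identDistrib_sum_row {n : ℕ} {Z : Fin n → Ω → 𝒵} (hZ : ∀ i, Measurable (Z i))
    (hQ : ∀ i, Pr.map (Z i) = Q) (hind : iIndepFun Z Pr) {h : 𝒵 → ℝ} (hh : Measurable h) :
    IdentDistrib (fun ω => ∑ i, h (Z i ω)) (fun x => ∑ i ∈ Finset.range n, h (x i)) Pr
      (Measure.infinitePi fun _ : ℕ => Q) := by
  have h1 : IdentDistrib (fun ω i => Z i ω) (fun x (i : Fin n) => x i) Pr
      (Measure.infinitePi fun _ : ℕ => Q) :=
    ⟨by fun_prop, (measurable_pi_lambda _ fun _ => measurable_pi_apply _).aemeasurable,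
      map_row_eq hZ hQ hind⟩
  have h2 := h1.comp (u := fun z : Fin n → 𝒵 => ∑ i, h (z i)) (by fun_prop)
  simpa [Function.comp_def, Finset.sum_range] using h2

lemma identDistrib_eval {h : 𝒵 → ℝ} (hh : Measurable h) (i : ℕ) :
    IdentDistrib (fun x : ℕ → 𝒵 => h (x i)) h (Measure.infinitePi fun _ : ℕ => Q) Q := by
  refine ⟨(hh.comp (measurable_pi_apply i)).aemeasurable, hh.aemeasurable, ?_⟩
  conv_rhs => rw [← Measure.infinitePi_map_eval (fun _ : ℕ => Q) i,
    Measure.map_map hh (measurable_pi_apply i)]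
  rfl

lemma iIndepFun_eval {h : 𝒵 → ℝ} (hh : Measurable h) :
    iIndepFun (fun i (x : ℕ → 𝒵) => h (x i)) (Measure.infinitePi fun _ : ℕ => Q) :=
  iIndepFun_infinitePi (P := fun _ : ℕ => Q) (X := fun _ z => h z) (fun _ => hh)

variable {n : ℕ → ℕ} {Z : ∀ m, Fin (n m) → Ω → 𝒵}

/-- Weak law of large numbers for rows. -/
lemma tendsto_sampleMean_row (hn : Tendsto n atTop atTop) (hZ : ∀ m i, Measurable (Z m i))
    (hQ : ∀ m i, Pr.map (Z m i) = Q) (hind : ∀ m, iIndepFun (Z m) Pr) {h : 𝒵 → ℝ}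
    (hh : Measurable h) (hint : Integrable h Q) :
    Tendsto (fun q : ℕ × Ω => sampleMean fun i => h (Z q.1 i q.2)) (inProb Pr)
      (𝓝 (∫ z, h z ∂Q)) := by
  set μ := Measure.infinitePi fun _ : ℕ => Q
  have hid := fun i => identDistrib_eval (Q := Q) hh i
  have h1 := strong_law_ae_real (μ := μ) (fun i x => h (x i))
    ((hid 0).integrable_iff.2 hint)
    (fun i k hik => (iIndepFun_eval hh).indepFun hik) (fun i => (hid i).trans (hid 0).symm)
  rw [(hid 0).integral_eq] at h1
  have h2 := tendstoInMeasure_of_tendsto_ae (μ := μ)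
    (f := fun n x => (∑ i ∈ Finset.range n, h (x i)) / (n : ℝ)) (g := fun _ => ∫ z, h z ∂Q)
    (fun n => by
      have : Measurable fun x : ℕ → 𝒵 => (∑ i ∈ Finset.range n, h (x i)) / (n : ℝ) := by fun_prop
      exact this.aestronglyMeasurable) h1
  rw [← tendstoInMeasure_const_iff (X := fun m ω => sampleMean fun i => h (Z m i ω))]
  intro ε hε
  refine ((h2 ε hε).comp hn).congr fun m => ?_
  -- Only the probability of a deviation event is transferred; almost sure convergence holds for the
  -- canonical sequence alone.
  have h3 := (identDistrib_sum_row (hZ m) (hQ m) (hind m) hh).measure_mem_eq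
    (s := {s | ε ≤ edist (s / (n m : ℝ)) (∫ z, h z ∂Q)})
    (measurableSet_le (by fun_prop) (by fun_prop))
  exact h3.symm

/-- Central limit theorem for rows, in terms of characteristic functions. -/
lemma tendsto_charFun_row (hn : Tendsto n atTop atTop) (hZ : ∀ m i, Measurable (Z m i))
    (hQ : ∀ m i, Pr.map (Z m i) = Q) (hind : ∀ m, iIndepFun (Z m) Pr) {h : 𝒵 → ℝ}
    (hh : Measurable h) (hL2 : MemLp h 2 Q) (t : ℝ) :
    Tendsto (fun m => charFun (Pr.map fun ω =>
        (√(n m))⁻¹ * (∑ i, h (Z m i ω) - n m * ∫ z, h z ∂Q)) t) atTop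
      (𝓝 (charFun (gaussianReal 0 (variance h Q).toNNReal) t)) := by
  have hid := fun i => identDistrib_eval (Q := Q) hh i
  have h1 := tendstoInDistribution_inv_sqrt_mul_sum_sub
    (P := Measure.infinitePi fun _ : ℕ => Q) (X := fun i x => h (x i))
    (Y := id) (P' := gaussianReal 0 (variance h Q).toNNReal)
    (by rw [(hid 0).variance_eq]; exact HasLaw.id) ((hid 0).memLp_iff.2 hL2) (iIndepFun_eval hh)
    (fun i => (hid i).trans (hid 0).symm)
  have h2 := (ProbabilityMeasure.tendsto_iff_tendsto_charFun.1 h1.tendsto) t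
  simp only [ProbabilityMeasure.coe_mk, Measure.map_id] at h2
  rw [(hid 0).integral_eq] at h2
  refine (h2.comp hn).congr fun m => ?_
  have h3 := ((identDistrib_sum_row (hZ m) (hQ m) (hind m) hh).comp
    (u := fun s => (√(n m))⁻¹ * (s - n m * ∫ z, h z ∂Q)) (by fun_prop)).map_eq
  simp only [Function.comp_def] at h3 ⊢
  rw [h3]

/-- The bound is uniform in `m` and is the source of all boundedness in probability used later. -/
lemma sqMomentLe_row (hZ : ∀ m i, Measurable (Z m i))
    (hQ : ∀ m i, Pr.map (Z m i) = Q) (hind : ∀ m, iIndepFun (Z m) Pr) {h : 𝒵 → ℝ}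
    (hh : Measurable h) (hL2 : MemLp h 2 Q) (m : ℕ) :
    SqMomentLe Pr (fun ω => (√(n m))⁻¹ * (∑ i, h (Z m i ω) - n m * ∫ z, h z ∂Q))
      (variance h Q) := by
  have hc := variance_nonneg h Q
  have h1 : SqMomentLe Pr (fun ω => ∑ i, (h (Z m i ω) - ∫ z, h z ∂Q))
      (Fintype.card (Fin (n m)) * variance h Q) := by
    refine sqMomentLe_sum (fun i => ?_) (fun i i' hne => ?_)
    · refine sqMomentLe_comp_of_indepFun (W := fun _ => ()) (Z := Z m i)
        (φ := fun _ z => h z - ∫ z, h z ∂Q) measurable_const (hZ m i) (hQ m i)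
        (indepFun_const_left _ _) (by fun_prop) hc (fun _ => ?_)
      rw [ofReal_variance hL2]
      rfl
    · refine integral_comp_eq_zero_of_indepFun (W := Z m i') (Z := Z m i)
        (φ := fun w z => (h z - ∫ z, h z ∂Q) * (h w - ∫ z, h z ∂Q)) (hZ m i') (hZ m i) (hQ m i)
        ((hind m).indepFun hne.symm) (by fun_prop) (fun w => ?_)
      rw [integral_mul_const, integral_sub (hL2.integrable (by norm_num)) (by fun_prop)]
      simp
  have h2 := h1.const_mul (√(n m))⁻¹
  simp only [Finset.sum_sub_distrib, Finset.sum_const, Finset.card_univ, Fintype.card_fin,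
    nsmul_eq_mul] at h2
  refine h2.mono ?_
  rw [inv_pow, Real.sq_sqrt (by positivity), ← mul_assoc]
  -- The factor `n⁻¹ * n` is `0` for an empty row and `1` otherwise, so nonempty rows are not
  -- required.
  exact mul_le_of_le_one_left hc (inv_mul_le_one)

end Rows

/-- If two independent sequences have asymptotically Gaussian characteristic functions, their
linear combinations are asymptotically Gaussian. -/
lemma tendstoInDistribution_add_const_mul {Ω : Type*} [MeasurableSpace Ω] {Pr : Measure Ω}
    [IsProbabilityMeasure Pr] {A B : ℕ → Ω → ℝ} (hA : ∀ m, Measurable (A m))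
    (hB : ∀ m, Measurable (B m)) (hAB : ∀ m, IndepFun (A m) (B m) Pr) {v w : ℝ} (hv : 0 ≤ v)
    (hw : 0 ≤ w)
    (hAv : ∀ t, Tendsto (fun m => charFun (Pr.map (A m)) t) atTop
      (𝓝 (charFun (gaussianReal 0 v.toNNReal) t)))
    (hBw : ∀ t, Tendsto (fun m => charFun (Pr.map (B m)) t) atTop
      (𝓝 (charFun (gaussianReal 0 w.toNNReal) t))) (a : ℝ) :
    TendstoInDistribution (fun m ω => A m ω + a * B m ω) atTop (id : ℝ → ℝ) (fun _ => Pr)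
      (gaussianReal 0 (v + a ^ 2 * w).toNNReal) := by
  refine ⟨fun m => ((hA m).add ((hB m).const_mul a)).aemeasurable, aemeasurable_id, ?_⟩
  refine ProbabilityMeasure.tendsto_iff_tendsto_charFun.2 fun t => ?_
  simp only [ProbabilityMeasure.coe_mk, Measure.map_id]
  -- The target characteristic function factors in the same way as that of the independent sum, the
  -- scaling by `a` becoming evaluation at `a * t`.
  have e : charFun (gaussianReal 0 (v + a ^ 2 * w).toNNReal) t =
      charFun (gaussianReal 0 v.toNNReal) t * charFun (gaussianReal 0 w.toNNReal) (a * t) := by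
    rw [charFun_gaussianReal, charFun_gaussianReal, charFun_gaussianReal, ← Complex.exp_add]
    congr 1
    simp only [Real.coe_toNNReal _ hv, Real.coe_toNNReal _ hw,
      Real.coe_toNNReal _ (add_nonneg hv (mul_nonneg (sq_nonneg a) hw))]
    push_cast
    ring
  rw [e]
  refine ((hAv t).mul (hBw (a * t))).congr fun m => ?_
  rw [← charFun_map_mul_comp (hB m).aemeasurable]
  have hi : IndepFun (A m) (fun ω => a * B m ω) Pr :=
    (hAB m).comp (φ := fun x => x) (ψ := fun x => a * x) measurable_id (measurable_const_mul a)
  rw [hi.charFun_map_fun_add_eq_mul (hA m).aemeasurable ((hB m).const_mul a).aemeasurable]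
  rfl

/-! ### Moment bounds for cross-fitted photo models -/

section Truncation

variable {𝒱 : Type*} {p : ℕ} [MeasurableSpace 𝒱]

lemma measurable_photo : Measurable fun z : Labeled 𝒱 p => z.2.1 :=
  measurable_fst.comp measurable_snd

/-- Mean squared distance of two photo models under the law `P`. -/
@[irreducible] noncomputable def sqDist (P : Measure (Labeled 𝒱 p)) (g f : 𝒱 → ℝ) : ENNReal :=
  ∫⁻ z, ‖f z.2.1 - g z.2.1‖ₑ ^ 2 ∂P

open Classical in
/-- The error `f - g` of a photo model `f`, replaced by zero if the mean squared error
exceeds `c`. -/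
@[irreducible] noncomputable def truncError (P : Measure (Labeled 𝒱 p)) (g : 𝒱 → ℝ) (c : ℝ)
    (f : 𝒱 → ℝ) (v : 𝒱) : ℝ :=
  if sqDist P g f ≤ ENNReal.ofReal c then f v - g v else 0

/-- Mean of the truncated error. -/
@[irreducible] noncomputable def truncBias (P : Measure (Labeled 𝒱 p)) (g : 𝒱 → ℝ) (c : ℝ)
    (f : 𝒱 → ℝ) : ℝ :=
  ∫ z, truncError P g c f z.2.1 ∂P

variable {P : Measure (Labeled 𝒱 p)} {g : 𝒱 → ℝ}

/-- Truncation makes this deterministic: it holds for every realization of the model, as the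
conditional second moment bounds require. -/
lemma lintegral_truncError_sq_le (c : ℝ) (f : 𝒱 → ℝ) :
    ∫⁻ z, ‖truncError P g c f z.2.1‖ₑ ^ 2 ∂P ≤ ENNReal.ofReal c := by
  unfold truncError
  split_ifs with h
  · unfold sqDist at h
    exact h
  · simp

lemma measurable_truncError_const [SFinite P] (hg : Measurable g) {f : 𝒱 → ℝ} (hf : Measurable f)
    (c : ℝ) : Measurable (truncError P g c f) := by
  unfold truncError
  split_ifs
  · exact hf.sub hg
  · exact measurable_const

lemma sqMomentLe_truncError [SFinite P] (hg : Measurable g) {f : 𝒱 → ℝ} (hf : Measurable f)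
    {c : ℝ} (hc : 0 ≤ c) : SqMomentLe P (fun z => truncError P g c f z.2.1) c :=
  sqMomentLe_of_lintegral hc
    ((measurable_truncError_const hg hf c).comp measurable_photo).aestronglyMeasurable
    (lintegral_truncError_sq_le (P := P) c f)

lemma lintegral_truncError_sub_bias_sq_le [IsProbabilityMeasure P] (hg : Measurable g)
    {f : 𝒱 → ℝ} (hf : Measurable f) {c : ℝ} (hc : 0 ≤ c) :
    ∫⁻ z, ‖truncError P g c f z.2.1 - truncBias P g c f‖ₑ ^ 2 ∂P ≤ ENNReal.ofReal c := by
  unfold truncBias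
  exact lintegral_enorm_sub_integral_sq_le hc (sqMomentLe_truncError hg hf hc).1.1
    (lintegral_truncError_sq_le c f)

lemma integral_truncError_sub_bias [IsProbabilityMeasure P] (hg : Measurable g)
    {f : 𝒱 → ℝ} (hf : Measurable f) {c : ℝ} (hc : 0 ≤ c) :
    ∫ z, (truncError P g c f z.2.1 - truncBias P g c f) ∂P = 0 := by
  rw [integral_sub ((sqMomentLe_truncError hg hf hc).1.integrable (by norm_num)) (by fun_prop)]
  simp [truncBias]

/-- Nonnegativity of the variance: the squared mean is at most the second moment. -/
lemma truncBias_sq_le [IsProbabilityMeasure P] (hg : Measurable g)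
    {f : 𝒱 → ℝ} (hf : Measurable f) {c : ℝ} (hc : 0 ≤ c) : truncBias P g c f ^ 2 ≤ c := by
  have h := sqMomentLe_truncError (P := P) hg hf hc
  have h1 := variance_nonneg (fun z : Labeled 𝒱 p => truncError P g c f z.2.1) P
  rw [variance_eq_sub h.1] at h1
  have h2 := h.2
  simp only [Pi.pow_apply] at h1
  unfold truncBias
  linarith

variable {𝒲 𝒴 : Type*} [MeasurableSpace 𝒲] [MeasurableSpace 𝒴] {F : 𝒲 → 𝒱 → ℝ}

lemma measurable_sqDist [SFinite P] (hg : Measurable g) (hF : Measurable (Function.uncurry F)) :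
    Measurable fun w => sqDist P g (F w) := by
  unfold sqDist
  refine Measurable.lintegral_prod_right' (ν := P)
    (f := fun q : 𝒲 × Labeled 𝒱 p => ‖F q.1 q.2.2.1 - g q.2.2.1‖ₑ ^ 2) ?_
  have h0 : Measurable fun q : 𝒲 × Labeled 𝒱 p => q.2.2.1 := measurable_photo.comp measurable_snd
  have h1 : Measurable fun q : 𝒲 × Labeled 𝒱 p => F q.1 q.2.2.1 :=
    hF.comp (measurable_fst.prodMk h0)
  exact (h1.sub (hg.comp h0)).enorm.pow_const 2

lemma measurable_truncError [SFinite P] (hg : Measurable g)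
    (hF : Measurable (Function.uncurry F)) (c : ℝ) {w : 𝒴 → 𝒲} (hw : Measurable w)
    {v : 𝒴 → 𝒱} (hv : Measurable v) :
    Measurable fun q => truncError P g c (F (w q)) (v q) := by
  unfold truncError
  refine Measurable.ite ?_ ((hF.comp (hw.prodMk hv)).sub (hg.comp hv)) measurable_const
  exact measurableSet_le ((measurable_sqDist hg hF).comp hw) measurable_const

lemma measurable_truncBias [SFinite P] (hg : Measurable g)
    (hF : Measurable (Function.uncurry F)) (c : ℝ) {w : 𝒴 → 𝒲} (hw : Measurable w) :
    Measurable fun q => truncBias P g c (F (w q)) := by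
  unfold truncBias
  have h : Measurable fun q : 𝒴 × Labeled 𝒱 p => truncError P g c (F (w q.1)) q.2.2.1 :=
    measurable_truncError hg hF c (hw.comp measurable_fst) (measurable_photo.comp measurable_snd)
  exact (StronglyMeasurable.integral_prod_right' (ν := P) h.stronglyMeasurable).measurable

end Truncation

/-- Taking the root lets mean squares be controlled by second moments only; no orthogonality and no
fourth moments are needed. -/
lemma sqMomentLe_sqrt_sum_sq {Ω ι : Type*} [MeasurableSpace Ω] {Pr : Measure Ω} [Fintype ι]
    {H : ι → Ω → ℝ} {c : ℝ} (hH : ∀ i, SqMomentLe Pr (H i) c) :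
    SqMomentLe Pr (fun ω => √(∑ i, H i ω ^ 2)) (Fintype.card ι * c) := by
  have hi : Integrable (fun ω => ∑ i, H i ω ^ 2) Pr :=
    integrable_finsetSum _ fun i _ => (hH i).1.integrable_sq
  have e : ∀ ω, √(∑ i, H i ω ^ 2) ^ 2 = ∑ i, H i ω ^ 2 := fun ω =>
    Real.sq_sqrt (Finset.sum_nonneg fun i _ => sq_nonneg _)
  constructor
  · rw [memLp_two_iff_integrable_sq (Real.continuous_sqrt.comp_aestronglyMeasurable hi.1)]
    simpa only [e] using hi
  · simp_rw [e]
    rw [integral_finsetSum _ fun i _ => (hH i).1.integrable_sq]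
    calc ∑ i, ∫ ω, H i ω ^ 2 ∂Pr ≤ ∑ _i : ι, c := Finset.sum_le_sum fun i _ => (hH i).2
      _ = _ := by simp

/-! ### Cross-fitting: independence of a model from the fields it predicts -/

namespace Run

variable {J R K p : ℕ} {𝒱 𝒰 Ω : Type*}

/-- The labeled data with the `i`-th field of zone `j` replaced by `z`. -/
def replaceAt (S : Run J R K p 𝒱 𝒰 Ω) (j : Fin J) (i : Fin (S.n j)) (z : Labeled 𝒱 p)
    (d : (j : Fin J) → Fin (S.n j) → Labeled 𝒱 p) : (j : Fin J) → Fin (S.n j) → Labeled 𝒱 p :=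
  fun j' i' => if (⟨j', i'⟩ : Σ j, Fin (S.n j)) = ⟨j, i⟩ then z else d j' i'

lemma replaceAt_of_ne {S : Run J R K p 𝒱 𝒰 Ω} {j : Fin J} {i i' : Fin (S.n j)} (h : i' ≠ i)
    (z : Labeled 𝒱 p)
    (d : (j : Fin J) → Fin (S.n j) → Labeled 𝒱 p) : S.replaceAt j i z d j i' = d j i' := by
  unfold replaceAt
  rw [if_neg]
  simpa using h

variable [MeasurableSpace 𝒱] {S : Run J R K p 𝒱 𝒰 Ω}

lemma measurable_replaceAt (j : Fin J) (i : Fin (S.n j)) (z : Labeled 𝒱 p) :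
    Measurable (S.replaceAt j i z) := by
  refine measurable_pi_lambda _ fun j' => measurable_pi_lambda _ fun i' => ?_
  unfold replaceAt
  split_ifs
  · exact measurable_const
  · fun_prop

variable [MeasurableSpace 𝒰] [MeasurableSpace Ω] {P : Fin J → Measure (Labeled 𝒱 p)}
  {Pr : Measure Ω}

/-- The essence of cross-fitting: a field of fold `k` can be overwritten without affecting the model
that predicts it. -/
lemma IsValid.train_replaceAt (hv : S.IsValid) {k : Fin K} {u : 𝒰} {j : Fin J} {i : Fin (S.n j)}
    (hk : S.fold u j i = k) (z : Labeled 𝒱 p) (d : (j : Fin J) → Fin (S.n j) → Labeled 𝒱 p) :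
    S.train k u (S.replaceAt j i z d) = S.train k u d := by
  refine hv.train_outside_fold k u _ _ fun j' i' hne => ?_
  unfold replaceAt
  rw [if_neg]
  rintro h
  obtain ⟨rfl, h⟩ := Sigma.mk.inj_iff.1 h
  exact hne (eq_of_heq h ▸ hk)

lemma IsValid.measurable_train_uncurry (hv : S.IsValid) (k : Fin K) :
    Measurable (Function.uncurry
      fun w : 𝒰 × ((j : Fin J) → Fin (S.n j) → Labeled 𝒱 p) => S.train k w.1 w.2) :=
  (hv.measurable_train k).comp
    ((measurable_fst.fst).prodMk ((measurable_fst.snd).prodMk measurable_snd))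

lemma IsValid.measurable_train_apply (hv : S.IsValid) (k : Fin K) (u : 𝒰)
    (d : (j : Fin J) → Fin (S.n j) → Labeled 𝒱 p) : Measurable (S.train k u d) :=
  (hv.measurable_train k).comp (measurable_const.prodMk (measurable_const.prodMk measurable_id))

lemma IsValid.measurableSet_fold (hv : S.IsValid) (j : Fin J) (i : Fin (S.n j)) (k : Fin K) :
    MeasurableSet {u | S.fold u j i = k} :=
  hv.measurable_fold j i (measurableSet_singleton k)

lemma IsSample.measurable_labData (hs : S.IsSample P Pr) : Measurable S.labData :=
  measurable_pi_lambda _ fun j => measurable_pi_lambda _ fun i => hs.measurable_lab j i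

variable [IsProbabilityMeasure Pr]

/-- Once field `i` is overwritten by a constant, the data set is a function of the other fields
only, hence independent of field `i`. -/
lemma IsSample.indepFun_replaceAt (hs : S.IsSample P Pr) (j : Fin J) (i : Fin (S.n j))
    (z : Labeled 𝒱 p) :
    IndepFun (fun ω => (S.aux ω, S.replaceAt j i z (S.labData ω))) (S.lab j i) Pr := by
  classical
  have hm := (measurable_replaceAt j i z).comp hs.measurable_labData
  refine indepFun_prodMk_left hs.measurable_aux hm (hs.measurable_lab j i) ?_ ?_
  · exact hs.indep_aux.comp (φ := fun u => u) (ψ := fun q => (S.replaceAt j i z q.1, q.1 j i))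
      measurable_id (((measurable_replaceAt j i z).comp measurable_fst).prodMk (by fun_prop))
  · have h := hs.indep_lab.indepFun_finset (Finset.univ.erase ⟨j, i⟩) {⟨j, i⟩} (by simp)
      (fun a => hs.measurable_lab a.1 a.2)
    have hji : (⟨j, i⟩ : Σ j, Fin (S.n j)) ∈ ({⟨j, i⟩} : Finset (Σ j, Fin (S.n j))) := by simp
    have hψ : Measurable fun t : ({⟨j, i⟩} : Finset (Σ j, Fin (S.n j))) → Labeled 𝒱 p =>
        t ⟨⟨j, i⟩, hji⟩ := measurable_pi_apply _
    have h2 := h.comp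
      (φ := fun (t : (a : (Finset.univ.erase ⟨j, i⟩ : Finset (Σ j, Fin (S.n j)))) →
        Labeled 𝒱 p) => (fun j' i' => if ha : (⟨j', i'⟩ : Σ j, Fin (S.n j)) = ⟨j, i⟩ then z else
        t ⟨⟨j', i'⟩, by simpa using ha⟩ : (j : Fin J) → Fin (S.n j) → Labeled 𝒱 p))
      (ψ := fun (t : ({⟨j, i⟩} : Finset (Σ j, Fin (S.n j))) → Labeled 𝒱 p) => t ⟨⟨j, i⟩, hji⟩)
      (by
        refine measurable_pi_lambda _ fun j' => measurable_pi_lambda _ fun i' => ?_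
        by_cases ha : (⟨j', i'⟩ : Σ j, Fin (S.n j)) = ⟨j, i⟩
        · simp only [ha, dite_true]; exact measurable_const
        · simp only [ha, dite_false]; exact measurable_pi_apply _)
      hψ
    convert h2 using 1
    · ext ω j' i' : 3
      simp only [Function.comp_apply, replaceAt, labData]
      split_ifs <;> rfl
    · rfl

lemma IsSample.indepFun_lab_unl (hs : S.IsSample P Pr) (j : Fin J) (i : Fin (S.N j)) :
    IndepFun (fun ω => (S.aux ω, S.labData ω)) (S.unl j i) Pr := by
  refine indepFun_prodMk_left hs.measurable_aux hs.measurable_labData (hs.measurable_unl j i) ?_ ?_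
  · exact hs.indep_aux.comp (φ := fun u => u) (ψ := fun q => (q.1, q.2 j i))
      measurable_id (by fun_prop)
  · exact hs.indep_lab_unl.comp (φ := fun u => u) (ψ := fun q => q j i) measurable_id (by fun_prop)

/-- Serves the cross terms: given the models and one unlabeled field, another unlabeled field is
still fresh. -/
lemma IsSample.indepFun_lab_unl_unl (hs : S.IsSample P Pr) (j : Fin J) {i i' : Fin (S.N j)}
    (h : i' ≠ i) :
    IndepFun (fun ω => ((S.aux ω, S.labData ω), S.unl j i' ω)) (S.unl j i) Pr := by
  have h1 : IndepFun (fun ω => (S.labData ω, S.unl j i' ω)) (S.unl j i) Pr :=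
    indepFun_prodMk_left hs.measurable_labData (hs.measurable_unl j i') (hs.measurable_unl j i)
      (hs.indep_lab_unl.comp (φ := fun u => u)
        (ψ := fun q : (j : Fin J) → Fin (S.N j) → Unlabeled 𝒱 p => (q j i', q j i)) measurable_id
        (by fun_prop))
      ((hs.indep_unl j).indepFun h)
  have h2 : IndepFun (fun ω => (S.aux ω, S.labData ω, S.unl j i' ω)) (S.unl j i) Pr :=
    indepFun_prodMk_left hs.measurable_aux
      (hs.measurable_labData.prodMk (hs.measurable_unl j i')) (hs.measurable_unl j i)
      (hs.indep_aux.comp (φ := fun u => u) (ψ := fun q :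
        ((j : Fin J) → Fin (S.n j) → Labeled 𝒱 p) × ((j : Fin J) → Fin (S.N j) → Unlabeled 𝒱 p) =>
        ((q.1, q.2 j i'), q.2 j i)) measurable_id
        (by fun_prop))
      h1
  exact h2.comp (φ := fun q => ((q.1, q.2.1), q.2.2)) (ψ := fun z => z) (by fun_prop)
    measurable_id

variable [∀ j, IsProbabilityMeasure (P j)] {g : 𝒱 → ℝ}

section Labeled

open Classical in
/-- Second moments of the centered errors of the fold `k` model on the labeled fields of that
fold. -/
lemma IsSample.sqMomentLe_lab_centered (hs : S.IsSample P Pr) (hv : S.IsValid) (hg : Measurable g)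
    {c : ℝ} (hc : 0 ≤ c) (k : Fin K) (j : Fin J) :
    SqMomentLe Pr (fun ω => ∑ i, if S.fold (S.aux ω) j i = k then
      truncError (P j) g c (S.ghat k ω) (S.lab j i ω).2.1 - truncBias (P j) g c (S.ghat k ω) else 0)
      (S.n j * c) := by
  obtain ⟨z₀⟩ : Nonempty (Labeled 𝒱 p) := nonempty_of_isProbabilityMeasure (P j)
  have hF := hv.measurable_train_uncurry k
  let D := (j : Fin J) → Fin (S.n j) → Labeled 𝒱 p
  let φ : Fin (S.n j) → 𝒰 × D → Labeled 𝒱 p → ℝ := fun i w z =>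
    if S.fold w.1 j i = k then
      truncError (P j) g c (S.train k w.1 w.2) z.2.1 - truncBias (P j) g c (S.train k w.1 w.2)
    else 0
  have hφ : ∀ i, Measurable (Function.uncurry (φ i)) := by
    intro i
    refine Measurable.ite ((hv.measurableSet_fold j i k).preimage (by fun_prop)) ?_ measurable_const
    refine Measurable.sub ?_ ?_
    · exact measurable_truncError hg hF c measurable_fst (measurable_photo.comp measurable_snd)
    · exact measurable_truncBias hg hF c measurable_fst
  -- A second index is allowed because in a cross term the factor of field `i'` must not depend on
  -- field `i` either.
  have hrep : ∀ i i' (w : 𝒰 × D) z, S.fold w.1 j i = k →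
      φ i' (w.1, S.replaceAt j i z₀ w.2) z = φ i' w z := by
    intro i i' w z hk
    simp only [φ, hv.train_replaceAt hk]
  have hrep' : ∀ i (w : 𝒰 × D) z, φ i (w.1, S.replaceAt j i z₀ w.2) z = φ i w z := by
    intro i w z
    by_cases hk : S.fold w.1 j i = k
    · exact hrep i i w z hk
    · simp [φ, hk]
  have hmeas : ∀ i, Measurable fun ω => (S.aux ω, S.replaceAt j i z₀ (S.labData ω)) := fun i =>
    hs.measurable_aux.prodMk ((measurable_replaceAt j i z₀).comp hs.measurable_labData)
  have key := sqMomentLe_sum (Pr := Pr)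
    (H := fun i ω => φ i (S.aux ω, S.labData ω) (S.lab j i ω)) (c := c) (fun i => ?_)
    (fun i i' hne => ?_)
  · simpa [φ, Run.ghat] using key
  · have h := sqMomentLe_comp_of_indepFun (hmeas i) (hs.measurable_lab j i) (hs.law_lab j i)
      (hs.indepFun_replaceAt j i z₀) (hφ i) hc (fun w => ?_)
    · simpa only [hrep' i (S.aux _, S.labData _)] using h
    · by_cases hk : S.fold w.1 j i = k
      · simp only [φ, hk, if_true]
        exact lintegral_truncError_sub_bias_sq_le hg (hv.measurable_train_apply k _ _) hc
      · simp [φ, hk]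
  -- With all data except field `i` frozen, the factor of `i'` is a constant and the factor of `i`
  -- has mean zero. If `i` is outside fold `k`, the product vanishes anyway.
  · have h := integral_comp_eq_zero_of_indepFun (hmeas i) (hs.measurable_lab j i) (hs.law_lab j i)
      (hs.indepFun_replaceAt j i z₀) (φ := fun w z => φ i w z * φ i' w (w.2 j i')) ?_ (fun w => ?_)
    · rw [← h]
      refine integral_congr_ae (ae_of_all _ fun ω => ?_)
      simp only [hrep' i (S.aux ω, S.labData ω)]
      by_cases hk : S.fold (S.aux ω) j i = k
      · rw [hrep i i' (S.aux ω, S.labData ω) _ hk, replaceAt_of_ne hne.symm]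
        rfl
      · simp [φ, hk]
    · refine (hφ i).mul ((hφ i').comp (?_ : Measurable
        fun q : (𝒰 × D) × Labeled 𝒱 p => (q.1, q.1.2 j i')))
      have h3 : Measurable fun d : D => d j i' :=
        (measurable_pi_apply i').comp (measurable_pi_apply j)
      exact measurable_fst.prodMk (h3.comp (measurable_snd.comp measurable_fst))
    · rw [integral_mul_const]
      by_cases hk : S.fold w.1 j i = k
      · simp only [φ, hk, if_true]
        rw [integral_truncError_sub_bias hg (hv.measurable_train_apply k _ _) hc, zero_mul]
      · simp [φ, hk]

open Classical in
lemma IsSample.sqMomentLe_lab_sqrt (hs : S.IsSample P Pr) (hv : S.IsValid) (hg : Measurable g)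
    {c : ℝ} (hc : 0 ≤ c) (k : Fin K) (j : Fin J) :
    SqMomentLe Pr (fun ω => √(∑ i, (if S.fold (S.aux ω) j i = k then
      truncError (P j) g c (S.ghat k ω) (S.lab j i ω).2.1 else 0) ^ 2)) (S.n j * c) := by
  obtain ⟨z₀⟩ : Nonempty (Labeled 𝒱 p) := nonempty_of_isProbabilityMeasure (P j)
  have hF := hv.measurable_train_uncurry k
  have key := sqMomentLe_sqrt_sum_sq (Pr := Pr) (c := c)
    (H := fun i ω => if S.fold (S.aux ω) j i = k then
      truncError (P j) g c (S.ghat k ω) (S.lab j i ω).2.1 else 0) (fun i => ?_)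
  · simpa using key
  have h := sqMomentLe_comp_of_indepFun
    (φ := fun w z => if S.fold w.1 j i = k then truncError (P j) g c (S.train k w.1 w.2) z.2.1
      else 0)
    (hs.measurable_aux.prodMk ((measurable_replaceAt j i z₀).comp hs.measurable_labData))
    (hs.measurable_lab j i) (hs.law_lab j i) (hs.indepFun_replaceAt j i z₀) ?_ hc (fun w => ?_)
  · convert h using 2 with ω
    by_cases hk : S.fold (S.aux ω) j i = k
    · simp only [hk, if_true, Function.comp_apply, hv.train_replaceAt hk]
      rfl
    · simp [hk]
  · refine Measurable.ite ((hv.measurableSet_fold j i k).preimage (by fun_prop)) ?_ measurable_const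
    exact measurable_truncError hg hF c measurable_fst (measurable_photo.comp measurable_snd)
  · by_cases hk : S.fold w.1 j i = k
    · simp only [hk, if_true]
      exact lintegral_truncError_sq_le c _
    · simp [hk]

end Labeled

section Unlabeled

/-- Unlabeled fields are independent of all training data, so no field has to be overwritten here.
-/
lemma IsSample.sqMomentLe_unl_centered (hs : S.IsSample P Pr) (hv : S.IsValid) (hg : Measurable g)
    {c : ℝ} (hc : 0 ≤ c) (k : Fin K) (j : Fin J) :
    SqMomentLe Pr (fun ω => ∑ i, (truncError (P j) g c (S.ghat k ω) (S.unl j i ω).1 -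
      truncBias (P j) g c (S.ghat k ω))) (S.N j * c) := by
  have hF := hv.measurable_train_uncurry k
  let D := (j : Fin J) → Fin (S.n j) → Labeled 𝒱 p
  let φ : 𝒰 × D → Unlabeled 𝒱 p → ℝ := fun w z =>
    truncError (P j) g c (S.train k w.1 w.2) z.1 - truncBias (P j) g c (S.train k w.1 w.2)
  have hφ : Measurable (Function.uncurry φ) := by
    refine Measurable.sub ?_ ?_
    · exact measurable_truncError hg hF c measurable_fst (measurable_fst.comp measurable_snd)
    · exact measurable_truncBias hg hF c measurable_fst
  have hmeas := hs.measurable_aux.prodMk hs.measurable_labData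
  have hφw : ∀ w, Measurable (φ w) := fun w => hφ.comp (measurable_const.prodMk measurable_id)
  have key := sqMomentLe_sum (Pr := Pr)
    (H := fun i ω => φ (S.aux ω, S.labData ω) (S.unl j i ω)) (c := c) (fun i => ?_)
    (fun i i' hne => ?_)
  · simpa [φ, Run.ghat] using key
  · refine sqMomentLe_comp_of_indepFun hmeas (hs.measurable_unl j i) (hs.law_unl j i)
      (hs.indepFun_lab_unl j i) hφ hc (fun w => ?_)
    rw [lintegral_map ((hφw w).enorm.pow_const 2) measurable_snd]
    exact lintegral_truncError_sub_bias_sq_le hg (hv.measurable_train_apply k _ _) hc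
  · refine integral_comp_eq_zero_of_indepFun (hmeas.prodMk (hs.measurable_unl j i'))
      (hs.measurable_unl j i) (hs.law_unl j i)
      (hs.indepFun_lab_unl_unl j hne.symm) (φ := fun w z => φ w.1 z * φ w.1 w.2) ?_ (fun w => ?_)
    · exact (hφ.comp (by fun_prop : Measurable
        fun q : ((𝒰 × D) × Unlabeled 𝒱 p) × Unlabeled 𝒱 p => (q.1.1, q.2))).mul
        (hφ.comp measurable_fst)
    · rw [integral_mul_const, integral_map measurable_snd.aemeasurable
        (hφw _).aestronglyMeasurable]
      simp only [φ]
      rw [integral_truncError_sub_bias hg (hv.measurable_train_apply k _ _) hc, zero_mul]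

lemma IsSample.sqMomentLe_unl_sqrt (hs : S.IsSample P Pr) (hv : S.IsValid) (hg : Measurable g)
    {c : ℝ} (hc : 0 ≤ c) (k : Fin K) (j : Fin J) :
    SqMomentLe Pr (fun ω => √(∑ i, truncError (P j) g c (S.ghat k ω) (S.unl j i ω).1 ^ 2))
      (S.N j * c) := by
  have hF := hv.measurable_train_uncurry k
  have key := sqMomentLe_sqrt_sum_sq (Pr := Pr) (c := c)
    (H := fun i ω => truncError (P j) g c (S.ghat k ω) (S.unl j i ω).1) (fun i => ?_)
  · simpa using key
  refine sqMomentLe_comp_of_indepFun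
    (φ := fun w z => truncError (P j) g c (S.train k w.1 w.2) z.1)
    (hs.measurable_aux.prodMk hs.measurable_labData)
    (hs.measurable_unl j i) (hs.law_unl j i) (hs.indepFun_lab_unl j i) ?_ hc (fun w => ?_)
  · exact measurable_truncError hg hF c measurable_fst (measurable_fst.comp measurable_snd)
  · have hm : Measurable fun z : Unlabeled 𝒱 p =>
        truncError (P j) g c (S.train k w.1 w.2) z.1 :=
      (measurable_truncError_const hg (hv.measurable_train_apply k _ _) c).comp measurable_fst
    rw [lintegral_map (hm.enorm.pow_const 2) measurable_snd]
    exact lintegral_truncError_sq_le c _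

end Unlabeled

end Run

/-! ### Cross-fitted predictions are asymptotically as good as those of the limiting model -/

lemma tendsto_of_ratio {n N : ℕ → ℕ} {ρ : ℝ} (hρ : 0 < ρ) (hN : Tendsto N atTop atTop)
    (hnN : Tendsto (fun m => (n m : ℝ) / (N m : ℝ)) atTop (𝓝 ρ)) : Tendsto n atTop atTop := by
  have h1 := hnN.pos_mul_atTop hρ (tendsto_natCast_atTop_atTop (R := ℝ) |>.comp hN)
  rw [← tendsto_natCast_atTop_iff (R := ℝ)]
  refine h1.congr' ?_
  filter_upwards [hN.eventually_gt_atTop 0] with m hm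
  have : (N m : ℝ) ≠ 0 := by positivity
  simp only [Function.comp_apply]
  field_simp

/-- In an even partition into `K` parts each part has almost the share `1 / K`. -/
lemma abs_card_fiber_div_sub_le {n K : ℕ} (φ : Fin n → Fin K)
    (h : ∀ k k', (Finset.univ.filter fun i => φ i = k).card ≤
      (Finset.univ.filter fun i => φ i = k').card + 1) (hn : 0 < n) (k : Fin K) :
    |((Finset.univ.filter fun i => φ i = k).card : ℝ) / n - 1 / K| ≤ 1 / n := by
  set a : Fin K → ℝ := fun k => ((Finset.univ.filter fun i => φ i = k).card : ℝ)
  have hK : 0 < K := k.pos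
  have hn' : (0 : ℝ) < n := by exact_mod_cast hn
  have hK' : (0 : ℝ) < K := by exact_mod_cast hK
  have hsum : ∑ k', a k' = n := by
    have := Finset.card_eq_sum_card_fiberwise (f := φ) (s := Finset.univ) (t := Finset.univ)
      (fun _ _ => by simp)
    simp only [Finset.card_univ, Fintype.card_fin] at this
    simp only [a]
    exact_mod_cast this.symm
  have hd : ∀ k', |a k - a k'| ≤ 1 := by
    intro k'
    have h1 : a k ≤ a k' + 1 := by simp only [a]; exact_mod_cast h k k'
    have h2 : a k' ≤ a k + 1 := by simp only [a]; exact_mod_cast h k' k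
    rw [abs_le]; constructor <;> linarith
  -- `n` is the sum of the fold sizes, so the left side is a sum of `K` differences of fold sizes,
  -- each at most one in absolute value.
  have h3 : |K * a k - n| ≤ K := by
    have : K * a k - n = ∑ k', (a k - a k') := by simp [hsum]
    rw [this]
    refine (Finset.abs_sum_le_sum_abs _ _).trans ((Finset.sum_le_sum fun k' _ => hd k').trans ?_)
    simp
  have h4 : a k / n - 1 / K = (K * a k - n) / (n * K) := by field_simp
  change |a k / n - 1 / K| ≤ _
  rw [h4, abs_div, abs_of_pos (by positivity : (0 : ℝ) < n * K), div_le_div_iff₀ (by positivity)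
    hn']
  nlinarith

lemma SqMomentLe.inv_sqrt_mul {Ω : Type*} [MeasurableSpace Ω] {Pr : Measure Ω} {X : Ω → ℝ}
    {c : ℝ} {n : ℕ} (hc : 0 ≤ c) (h : SqMomentLe Pr X (n * c)) :
    SqMomentLe Pr (fun ω => (√n)⁻¹ * X ω) c := by
  refine (h.const_mul _).mono ?_
  rw [inv_pow, Real.sq_sqrt (by positivity), ← mul_assoc]
  exact mul_le_of_le_one_left hc inv_mul_le_one

section FoldDecomposition

variable {J R K p : ℕ} {𝒱 𝒰 Ω : Type*}

lemma yhatLab_sub_eq_sum (S : Run J R K p 𝒱 𝒰 Ω) (g : 𝒱 → ℝ) (j : Fin J) (ω : Ω)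
    (i : Fin (S.n j)) :
    S.yhatLab j ω i - g (S.lab j i ω).2.1 = ∑ k, if S.fold (S.aux ω) j i = k then
      S.ghat k ω (S.lab j i ω).2.1 - g (S.lab j i ω).2.1 else 0 := by
  simp [Run.yhatLab]

lemma yhatUnl_sub_eq_sum (hK : 0 < K) (S : Run J R K p 𝒱 𝒰 Ω) (g : 𝒱 → ℝ) (j : Fin J) (ω : Ω)
    (i : Fin (S.N j)) :
    S.yhatUnl j ω i - g (S.unl j i ω).1 =
      (∑ k, (S.ghat k ω (S.unl j i ω).1 - g (S.unl j i ω).1)) / K := by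
  have : (K : ℝ) ≠ 0 := by positivity
  rw [Run.yhatUnl, Finset.sum_sub_distrib]
  simp only [Finset.sum_const, Finset.card_univ, Fintype.card_fin, nsmul_eq_mul]
  field_simp

/-- The mean prediction error on the labeled fields minus that on the unlabeled fields, decomposed
by folds. -/
lemma sqrt_mul_sampleMean_sub_eq (hK : 0 < K) (S : Run J R K p 𝒱 𝒰 Ω) (g : 𝒱 → ℝ) (j : Fin J)
    (ω : Ω) (hn : 0 < S.n j) (hN : 0 < S.N j) (b : Fin K → ℝ) :
    √(S.n j) * (sampleMean (fun i => S.yhatLab j ω i - g (S.lab j i ω).2.1) -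
        sampleMean (fun i => S.yhatUnl j ω i - g (S.unl j i ω).1)) =
      ∑ k, (((√(S.n j))⁻¹ * ∑ i, if S.fold (S.aux ω) j i = k then
          S.ghat k ω (S.lab j i ω).2.1 - g (S.lab j i ω).2.1 - b k else 0) -
        √((S.n j : ℝ) / S.N j) / K * ((√(S.N j))⁻¹ * ∑ i,
          (S.ghat k ω (S.unl j i ω).1 - g (S.unl j i ω).1 - b k)) +
        √(S.n j) * (((Finset.univ.filter fun i => S.fold (S.aux ω) j i = k).card : ℝ) / S.n j
          - 1 / K) * b k) := by
  have hn' : (0 : ℝ) < S.n j := by exact_mod_cast hn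
  have hN' : (0 : ℝ) < S.N j := by exact_mod_cast hN
  have hK' : (0 : ℝ) < K := by exact_mod_cast hK
  -- The shift `b k` may be arbitrary: it enters the labeled side with the share of fold `k` and the
  -- unlabeled side with weight `1 / K`, and the third summand repairs the mismatch.
  have e1 : ∀ k, (∑ i, if S.fold (S.aux ω) j i = k then
      S.ghat k ω (S.lab j i ω).2.1 - g (S.lab j i ω).2.1 - b k else 0) =
      (∑ i, if S.fold (S.aux ω) j i = k then
        S.ghat k ω (S.lab j i ω).2.1 - g (S.lab j i ω).2.1 else 0) -
      ((Finset.univ.filter fun i => S.fold (S.aux ω) j i = k).card : ℝ) * b k := by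
    intro k
    rw [← Finset.sum_filter, ← Finset.sum_filter, Finset.sum_sub_distrib]
    simp
  have e2 : ∀ k, (∑ i, (S.ghat k ω (S.unl j i ω).1 - g (S.unl j i ω).1 - b k)) =
      (∑ i, (S.ghat k ω (S.unl j i ω).1 - g (S.unl j i ω).1)) - S.N j * b k := by
    intro k
    rw [Finset.sum_sub_distrib]
    simp
  simp only [sampleMean, yhatLab_sub_eq_sum, yhatUnl_sub_eq_sum hK, e1, e2]
  rw [Finset.sum_comm, ← Finset.sum_div, Finset.sum_comm (s := (Finset.univ : Finset (Fin (S.N j)))),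
    Finset.sum_div, Finset.sum_div, Finset.sum_div, ← Finset.sum_sub_distrib, Finset.mul_sum]
  refine Finset.sum_congr rfl fun k _ => ?_
  rw [Real.sqrt_div hn'.le]
  -- Naming the square roots of the sample sizes turns the claim into an identity of rational
  -- functions.
  obtain ⟨s, hs, hs'⟩ : ∃ s : ℝ, 0 < s ∧ (S.n j : ℝ) = s ^ 2 :=
    ⟨√(S.n j), by positivity, (Real.sq_sqrt hn'.le).symm⟩
  obtain ⟨t, ht, ht'⟩ : ∃ t : ℝ, 0 < t ∧ (S.N j : ℝ) = t ^ 2 :=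
    ⟨√(S.N j), by positivity, (Real.sq_sqrt hN'.le).symm⟩
  rw [hs', ht', Real.sqrt_sq hs.le, Real.sqrt_sq ht.le]
  field_simp
  ring

end FoldDecomposition

/-- Mean error of a photo model. -/
noncomputable def bias {𝒱 : Type*} {p : ℕ} [MeasurableSpace 𝒱] (P : Measure (Labeled 𝒱 p))
    (g f : 𝒱 → ℝ) : ℝ := ∫ z, (f z.2.1 - g z.2.1) ∂P

section CrossFit

variable {J R K p : ℕ} {𝒱 𝒰 Ω : Type*} [MeasurableSpace 𝒱] [MeasurableSpace Ω]
  {Pr : Measure Ω} {P : Fin J → Measure (Labeled 𝒱 p)} {S : ℕ → Run J R K p 𝒱 𝒰 Ω} {g : 𝒱 → ℝ} {j : Fin J}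

/-- The truncation is inactive with probability tending to one, whatever level `c > 0` is chosen. -/
lemma eventually_truncError_eq {k : Fin K} (hd : Tendsto
      (fun q : ℕ × Ω => sqDist (P j) g ((S q.1).ghat k q.2)) (inProb Pr) (𝓝 0))
    {c : ℝ} (hc : 0 < c) : ∀ᶠ q in inProb Pr,
      (∀ v, truncError (P j) g c ((S q.1).ghat k q.2) v = (S q.1).ghat k q.2 v - g v) ∧
      truncBias (P j) g c ((S q.1).ghat k q.2) = bias (P j) g ((S q.1).ghat k q.2) := by
  filter_upwards [hd.eventually_le_const (u := ENNReal.ofReal c) (by simpa using hc)] with q hq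
  have h : ∀ v, truncError (P j) g c ((S q.1).ghat k q.2) v = (S q.1).ghat k q.2 v - g v := by
    intro v
    rw [truncError, if_pos hq]
  refine ⟨h, ?_⟩
  simp only [truncBias, bias, h]

variable [MeasurableSpace 𝒰] [∀ j, IsProbabilityMeasure (P j)]

lemma tendsto_bias (hvalid : ∀ m, (S m).IsValid) (hg : Measurable g) (k : Fin K) (hd : Tendsto
      (fun q : ℕ × Ω => sqDist (P j) g ((S q.1).ghat k q.2)) (inProb Pr) (𝓝 0)) :
    Tendsto (fun q : ℕ × Ω => bias (P j) g ((S q.1).ghat k q.2)) (inProb Pr) (𝓝 0) := by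
  rw [Metric.tendsto_nhds]
  intro e he
  -- At this level the bias is at most `e / 2`, strictly below `e`.
  have hc : 0 < (e / 2) ^ 2 := by positivity
  filter_upwards [eventually_truncError_eq hd hc] with q hq
  have h := truncBias_sq_le (P := P j) hg ((hvalid q.1).measurable_train_apply k
    ((S q.1).aux q.2) ((S q.1).labData q.2)) hc.le
  change truncBias (P j) g _ ((S q.1).ghat k q.2) ^ 2 ≤ _ at h
  rw [hq.2] at h
  rw [dist_zero_right, Real.norm_eq_abs]
  exact (abs_le_of_sq_le_sq h (by positivity)).trans_lt (by linarith)

variable [IsProbabilityMeasure Pr]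

/-- For every `c` the truncated normalized sum has second moment at most `c` at all stages, and it
is the actual sum with probability tending to one. -/
lemma tendsto_lab_centered (hvalid : ∀ m, (S m).IsValid) (hsample : ∀ m, (S m).IsSample P Pr)
    (hg : Measurable g) (k : Fin K) (hd : Tendsto
      (fun q : ℕ × Ω => sqDist (P j) g ((S q.1).ghat k q.2)) (inProb Pr) (𝓝 0)) :
    Tendsto (fun q : ℕ × Ω => (√((S q.1).n j))⁻¹ * ∑ i,
      if (S q.1).fold ((S q.1).aux q.2) j i = k then
        (S q.1).ghat k q.2 ((S q.1).lab j i q.2).2.1 - g ((S q.1).lab j i q.2).2.1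
          - bias (P j) g ((S q.1).ghat k q.2) else 0) (inProb Pr) (𝓝 0) := by
  refine tendsto_zero_of_sqMomentLe (X := fun m ω => (√((S m).n j))⁻¹ * ∑ i,
      if (S m).fold ((S m).aux ω) j i = k then
        (S m).ghat k ω ((S m).lab j i ω).2.1 - g ((S m).lab j i ω).2.1
          - bias (P j) g ((S m).ghat k ω) else 0) fun c hc => ?_
  refine ⟨_, Eventually.of_forall fun m =>
    ((hsample m).sqMomentLe_lab_centered (hvalid m) hg hc.le k j).inv_sqrt_mul hc.le, ?_⟩
  filter_upwards [eventually_truncError_eq hd hc] with q hq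
  simp only [hq.1, hq.2]

lemma tendsto_unl_centered (hvalid : ∀ m, (S m).IsValid) (hsample : ∀ m, (S m).IsSample P Pr)
    (hg : Measurable g) (k : Fin K) (hd : Tendsto
      (fun q : ℕ × Ω => sqDist (P j) g ((S q.1).ghat k q.2)) (inProb Pr) (𝓝 0)) :
    Tendsto (fun q : ℕ × Ω => (√((S q.1).N j))⁻¹ * ∑ i,
      ((S q.1).ghat k q.2 ((S q.1).unl j i q.2).1 - g ((S q.1).unl j i q.2).1
          - bias (P j) g ((S q.1).ghat k q.2))) (inProb Pr) (𝓝 0) := by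
  refine tendsto_zero_of_sqMomentLe (X := fun m ω => (√((S m).N j))⁻¹ * ∑ i,
      ((S m).ghat k ω ((S m).unl j i ω).1 - g ((S m).unl j i ω).1
          - bias (P j) g ((S m).ghat k ω))) fun c hc => ?_
  refine ⟨_, Eventually.of_forall fun m =>
    ((hsample m).sqMomentLe_unl_centered (hvalid m) hg hc.le k j).inv_sqrt_mul hc.le, ?_⟩
  filter_upwards [eventually_truncError_eq hd hc] with q hq
  simp only [hq.1, hq.2]

lemma sq_inv_sqrt_mul_sqrt_sum {n : ℕ} (a : Fin n → ℝ) :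
    ((√n)⁻¹ * √(∑ i, a i ^ 2)) ^ 2 = (∑ i, a i ^ 2) / n := by
  rw [mul_pow, inv_pow, Real.sq_sqrt (by positivity),
    Real.sq_sqrt (Finset.sum_nonneg fun i _ => sq_nonneg _)]
  ring

/-- The root mean square is shown to vanish first, since second moments control it; squaring the
limit finishes. -/
lemma tendsto_lab_sq (hvalid : ∀ m, (S m).IsValid) (hsample : ∀ m, (S m).IsSample P Pr)
    (hg : Measurable g) (k : Fin K) (hd : Tendsto
      (fun q : ℕ × Ω => sqDist (P j) g ((S q.1).ghat k q.2)) (inProb Pr) (𝓝 0)) :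
    Tendsto (fun q : ℕ × Ω => (∑ i,
      (if (S q.1).fold ((S q.1).aux q.2) j i = k then
        (S q.1).ghat k q.2 ((S q.1).lab j i q.2).2.1 - g ((S q.1).lab j i q.2).2.1 else 0) ^ 2) /
        ((S q.1).n j : ℝ)) (inProb Pr) (𝓝 0) := by
  have h := tendsto_zero_of_sqMomentLe (Pr := Pr)
    (X := fun m ω => (√((S m).n j))⁻¹ * √(∑ i,
      (if (S m).fold ((S m).aux ω) j i = k then
        (S m).ghat k ω ((S m).lab j i ω).2.1 - g ((S m).lab j i ω).2.1 else 0) ^ 2)) fun c hc => by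
    refine ⟨_, Eventually.of_forall fun m =>
      ((hsample m).sqMomentLe_lab_sqrt (hvalid m) hg hc.le k j).inv_sqrt_mul hc.le, ?_⟩
    filter_upwards [eventually_truncError_eq hd hc] with q hq
    simp only [hq.1]
  have h2 := h.pow 2
  simp only [sq_inv_sqrt_mul_sqrt_sum] at h2
  simpa using h2

lemma tendsto_unl_sq (hvalid : ∀ m, (S m).IsValid) (hsample : ∀ m, (S m).IsSample P Pr)
    (hg : Measurable g) (k : Fin K) (hd : Tendsto
      (fun q : ℕ × Ω => sqDist (P j) g ((S q.1).ghat k q.2)) (inProb Pr) (𝓝 0)) :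
    Tendsto (fun q : ℕ × Ω => (∑ i,
      ((S q.1).ghat k q.2 ((S q.1).unl j i q.2).1 - g ((S q.1).unl j i q.2).1) ^ 2) /
        ((S q.1).N j : ℝ)) (inProb Pr) (𝓝 0) := by
  have h := tendsto_zero_of_sqMomentLe (Pr := Pr)
    (X := fun m ω => (√((S m).N j))⁻¹ * √(∑ i,
      ((S m).ghat k ω ((S m).unl j i ω).1 - g ((S m).unl j i ω).1) ^ 2)) fun c hc => by
    refine ⟨_, Eventually.of_forall fun m =>
      ((hsample m).sqMomentLe_unl_sqrt (hvalid m) hg hc.le k j).inv_sqrt_mul hc.le, ?_⟩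
    filter_upwards [eventually_truncError_eq hd hc] with q hq
    simp only [hq.1]
  have h2 := h.pow 2
  simp only [sq_inv_sqrt_mul_sqrt_sum] at h2
  simpa using h2

variable {ρ : ℝ}

/-- The errors of the cross-fitted predictions cancel at the `√n` scale. -/
lemma tendsto_sqrt_mul_sampleMean_error_sub (hK : 0 < K)
    (hvalid : ∀ m, (S m).IsValid) (hsample : ∀ m, (S m).IsSample P Pr) (hg : Measurable g)
    (hn : Tendsto (fun m => (S m).n j) atTop atTop)
    (hN : Tendsto (fun m => (S m).N j) atTop atTop)
    (hnN : Tendsto (fun m => ((S m).n j : ℝ) / ((S m).N j : ℝ)) atTop (𝓝 ρ))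
    (hd : ∀ k, Tendsto
      (fun q : ℕ × Ω => sqDist (P j) g ((S q.1).ghat k q.2)) (inProb Pr) (𝓝 0)) :
    Tendsto (fun q : ℕ × Ω => √((S q.1).n j) *
      (sampleMean (fun i => (S q.1).yhatLab j q.2 i - g ((S q.1).lab j i q.2).2.1) -
        sampleMean (fun i => (S q.1).yhatUnl j q.2 i - g ((S q.1).unl j i q.2).1)))
      (inProb Pr) (𝓝 0) := by
  -- `√n` times a fold imbalance of at most `1 / n` is at most one, so a bias tending to zero at any
  -- rate is harmless.
  have hb : ∀ k, Tendsto (fun q : ℕ × Ω => √((S q.1).n j) *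
      (((Finset.univ.filter fun i => (S q.1).fold ((S q.1).aux q.2) j i = k).card : ℝ) /
        (S q.1).n j - 1 / K) * bias (P j) g ((S q.1).ghat k q.2)) (inProb Pr) (𝓝 0) := by
    intro k
    have h0 := (tendsto_bias hvalid hg k (hd k)).abs
    rw [abs_zero] at h0
    refine squeeze_zero_norm' ?_ h0
    filter_upwards [tendsto_fst_inProb.eventually (hn.eventually_gt_atTop 0)] with q hq
    have hq' : (1 : ℝ) ≤ (S q.1).n j := by exact_mod_cast hq
    rw [norm_mul, norm_mul, Real.norm_eq_abs, Real.norm_eq_abs, Real.norm_eq_abs]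
    refine mul_le_of_le_one_left (abs_nonneg _) ?_
    calc _ ≤ |√((S q.1).n j)| * (1 / (S q.1).n j : ℝ) := by
          gcongr
          exact abs_card_fiber_div_sub_le _ ((hvalid q.1).fold_even _ j) hq k
      _ ≤ 1 := by
          rw [abs_of_nonneg (Real.sqrt_nonneg _), mul_one_div, div_le_one (by positivity)]
          exact Real.sqrt_le_iff.2 ⟨by positivity, by nlinarith⟩
  have hr : Tendsto (fun q : ℕ × Ω => √(((S q.1).n j : ℝ) / (S q.1).N j) / K) (inProb Pr)
      (𝓝 (√ρ / K)) := (hnN.sqrt.div_const _).comp tendsto_fst_inProb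
  have h := tendsto_finsetSum (Finset.univ : Finset (Fin K)) fun k _ =>
    ((tendsto_lab_centered hvalid hsample hg k (hd k)).sub
      (hr.mul (tendsto_unl_centered hvalid hsample hg k (hd k)))).add (hb k)
  simp only [mul_zero, sub_zero, add_zero, Finset.sum_const_zero] at h
  refine h.congr' ?_
  filter_upwards [tendsto_fst_inProb.eventually (hn.eventually_gt_atTop 0),
    tendsto_fst_inProb.eventually (hN.eventually_gt_atTop 0)] with q hq hq'
  exact (sqrt_mul_sampleMean_sub_eq hK (S q.1) g j q.2 hq hq' _).symm

lemma tendsto_sampleMean_lab_error_sq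
    (hvalid : ∀ m, (S m).IsValid) (hsample : ∀ m, (S m).IsSample P Pr) (hg : Measurable g)
    (hd : ∀ k, Tendsto
      (fun q : ℕ × Ω => sqDist (P j) g ((S q.1).ghat k q.2)) (inProb Pr) (𝓝 0)) :
    Tendsto (fun q : ℕ × Ω =>
      sampleMean (fun i => ((S q.1).yhatLab j q.2 i - g ((S q.1).lab j i q.2).2.1) ^ 2))
      (inProb Pr) (𝓝 0) := by
  have h := tendsto_finsetSum (Finset.univ : Finset (Fin K)) fun k _ =>
    tendsto_lab_sq hvalid hsample hg k (hd k)
  simp only [Finset.sum_const_zero] at h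
  refine h.congr fun q => ?_
  rw [sampleMean, ← Finset.sum_div, Finset.sum_comm]
  congr 1
  -- Each field belongs to exactly one fold, so a single square survives.
  refine Finset.sum_congr rfl fun i _ => ?_
  simp [Run.yhatLab, ite_pow]

lemma tendsto_sampleMean_unl_error_sq (hK : 0 < K)
    (hvalid : ∀ m, (S m).IsValid) (hsample : ∀ m, (S m).IsSample P Pr) (hg : Measurable g)
    (hd : ∀ k, Tendsto
      (fun q : ℕ × Ω => sqDist (P j) g ((S q.1).ghat k q.2)) (inProb Pr) (𝓝 0)) :
    Tendsto (fun q : ℕ × Ω =>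
      sampleMean (fun i => ((S q.1).yhatUnl j q.2 i - g ((S q.1).unl j i q.2).1) ^ 2))
      (inProb Pr) (𝓝 0) := by
  have hK' : (1 : ℝ) ≤ K := by exact_mod_cast hK
  have h := tendsto_finsetSum (Finset.univ : Finset (Fin K)) fun k _ =>
    tendsto_unl_sq hvalid hsample hg k (hd k)
  simp only [Finset.sum_const_zero] at h
  refine squeeze_zero (fun q => ?_) (fun q => ?_) h
  · exact div_nonneg (Finset.sum_nonneg fun i _ => sq_nonneg _) (by positivity)
  · rw [sampleMean, ← Finset.sum_div, Finset.sum_comm]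
    gcongr with i
    rw [yhatUnl_sub_eq_sum hK, div_pow, div_le_iff₀ (by positivity)]
    -- Cauchy–Schwarz over the models costs a factor `K`, which the `K ^ 2` from averaging absorbs.
    have h1 := sq_sum_le_card_mul_sum_sq (s := (Finset.univ : Finset (Fin K)))
      (f := fun k => (S q.1).ghat k q.2 ((S q.1).unl j i q.2).1 - g ((S q.1).unl j i q.2).1)
    simp only [Finset.card_univ, Fintype.card_fin] at h1
    refine h1.trans ?_
    have h2 : 0 ≤ ∑ k, ((S q.1).ghat k q.2 ((S q.1).unl j i q.2).1 -
      g ((S q.1).unl j i q.2).1) ^ 2 := Finset.sum_nonneg fun i _ => sq_nonneg _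
    nlinarith

end CrossFit

/-! ### Stability of the sample moments -/

lemma sampleMean_add {n : ℕ} (a b : Fin n → ℝ) :
    sampleMean (fun i => a i + b i) = sampleMean a + sampleMean b := by
  simp [sampleMean, Finset.sum_add_distrib, add_div]

lemma sampleMean_sub {n : ℕ} (a b : Fin n → ℝ) :
    sampleMean (fun i => a i - b i) = sampleMean a - sampleMean b := by
  simp [sampleMean, Finset.sum_sub_distrib, sub_div]

lemma sampleMean_const_mul {n : ℕ} (c : ℝ) (a : Fin n → ℝ) :
    sampleMean (fun i => c * a i) = c * sampleMean a := by
  simp [sampleMean, ← Finset.mul_sum, mul_div_assoc]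

lemma sampleMean_sum {n : ℕ} {ι : Type*} (s : Finset ι) (a : ι → Fin n → ℝ) :
    sampleMean (fun i => ∑ c ∈ s, a c i) = ∑ c ∈ s, sampleMean (a c) := by
  simp only [sampleMean]
  rw [Finset.sum_comm, Finset.sum_div]

lemma sampleMean_nonneg {n : ℕ} {a : Fin n → ℝ} (h : ∀ i, 0 ≤ a i) : 0 ≤ sampleMean a :=
  div_nonneg (Finset.sum_nonneg fun i _ => h i) (by positivity)

lemma sampleMean_mono {n : ℕ} {a b : Fin n → ℝ} (h : ∀ i, a i ≤ b i) :
    sampleMean a ≤ sampleMean b :=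
  div_le_div_of_nonneg_right (Finset.sum_le_sum fun i _ => h i) (by positivity)

lemma sampleMean_mul_sq_le {n : ℕ} (a b : Fin n → ℝ) :
    sampleMean (fun i => a i * b i) ^ 2 ≤
      sampleMean (fun i => a i ^ 2) * sampleMean (fun i => b i ^ 2) := by
  simp only [sampleMean]
  rw [div_pow, div_mul_div_comm, ← sq]
  exact div_le_div_of_nonneg_right (Finset.sum_mul_sq_le_sq_mul_sq _ _ _) (by positivity)

section Along

variable {α : Type*} {F : Filter α} {n N : α → ℕ}

lemma tendsto_sampleMean_mul_zero {a d : ∀ q, Fin (n q) → ℝ} {c : ℝ}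
    (ha : Tendsto (fun q => sampleMean fun i => a q i ^ 2) F (𝓝 c))
    (hd : Tendsto (fun q => sampleMean fun i => d q i ^ 2) F (𝓝 0)) :
    Tendsto (fun q => sampleMean fun i => a q i * d q i) F (𝓝 0) := by
  have h := (ha.mul hd).sqrt
  rw [mul_zero, Real.sqrt_zero] at h
  refine squeeze_zero_norm (fun q => ?_) h
  rw [Real.norm_eq_abs, ← Real.sqrt_sq_eq_abs]
  exact Real.sqrt_le_sqrt (sampleMean_mul_sq_le _ _)

lemma tendsto_sampleMean_mul_of_close {a f f' : ∀ q, Fin (n q) → ℝ} {c e : ℝ}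
    (ha : Tendsto (fun q => sampleMean fun i => a q i ^ 2) F (𝓝 c))
    (hd : Tendsto (fun q => sampleMean fun i => (f q i - f' q i) ^ 2) F (𝓝 0))
    (hf : Tendsto (fun q => sampleMean fun i => a q i * f' q i) F (𝓝 e)) :
    Tendsto (fun q => sampleMean fun i => a q i * f q i) F (𝓝 e) := by
  have h := hf.add (tendsto_sampleMean_mul_zero ha hd)
  rw [add_zero] at h
  refine h.congr fun q => ?_
  rw [← sampleMean_add]
  congr 1
  ext i
  ring

lemma tendsto_sampleMean_one (hn : Tendsto n F atTop) :
    Tendsto (fun q => sampleMean fun _ : Fin (n q) => (1 : ℝ) ^ 2) F (𝓝 1) := by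
  refine tendsto_const_nhds.congr' ?_
  filter_upwards [hn.eventually_gt_atTop 0] with q hq
  have : (n q : ℝ) ≠ 0 := by positivity
  simp [sampleMean, this]

lemma tendsto_sampleMean_of_close (hn : Tendsto n F atTop) {f f' : ∀ q, Fin (n q) → ℝ} {e : ℝ}
    (hd : Tendsto (fun q => sampleMean fun i => (f q i - f' q i) ^ 2) F (𝓝 0))
    (hf : Tendsto (fun q => sampleMean (f' q)) F (𝓝 e)) :
    Tendsto (fun q => sampleMean (f q)) F (𝓝 e) := by
  have h := tendsto_sampleMean_mul_of_close (a := fun _ _ => 1) (tendsto_sampleMean_one hn) hd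
    (by simpa using hf)
  simpa using h

lemma tendsto_sampleMean_sq_of_close {f f' : ∀ q, Fin (n q) → ℝ} {e : ℝ}
    (hd : Tendsto (fun q => sampleMean fun i => (f q i - f' q i) ^ 2) F (𝓝 0))
    (hf : Tendsto (fun q => sampleMean fun i => f' q i ^ 2) F (𝓝 e)) :
    Tendsto (fun q => sampleMean fun i => f q i ^ 2) F (𝓝 e) := by
  have h := (hf.add ((tendsto_sampleMean_mul_zero hf hd).const_mul 2)).add hd
  rw [mul_zero, add_zero, add_zero] at h
  refine h.congr fun q => ?_
  rw [← sampleMean_const_mul, ← sampleMean_add, ← sampleMean_add]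
  congr 1
  ext i
  ring

/-- Raw moments are what the law of large numbers controls. At `n = 1` both sides are zero, by
division by zero. -/
lemma sampleCov_eq {n : ℕ} (hn : 0 < n) (y f : Fin n → ℝ) :
    sampleCov y f = (n : ℝ) / (n - 1) *
      (sampleMean (fun i => y i * f i) - sampleMean y * sampleMean f) := by
  have hn' : (n : ℝ) ≠ 0 := by positivity
  have e : ∑ i, (y i - sampleMean y) * (f i - sampleMean f) =
      (∑ i, y i * f i) - n * (sampleMean y * sampleMean f) := by
    have h : ∀ i, (y i - sampleMean y) * (f i - sampleMean f) =
        y i * f i - sampleMean f * y i - sampleMean y * f i + sampleMean y * sampleMean f := by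
      intro i; ring
    simp_rw [h]
    rw [Finset.sum_add_distrib, Finset.sum_sub_distrib, Finset.sum_sub_distrib, ← Finset.mul_sum,
      ← Finset.mul_sum]
    have h1 : ∑ i, y i = n * sampleMean y := by rw [sampleMean]; field_simp
    have h2 : ∑ i, f i = n * sampleMean f := by rw [sampleMean]; field_simp
    rw [h1, h2]
    simp
    ring
  rw [sampleCov, e]
  have h3 : sampleMean (fun i => y i * f i) = (∑ i, y i * f i) / n := rfl
  rw [h3, div_mul_eq_mul_div]
  congr 1
  field_simp

lemma pooledVar_eq {n N : ℕ} (hn : 0 < n) (hN : 0 < N) (f : Fin n → ℝ) (u : Fin N → ℝ) :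
    pooledVar f u = ((n : ℝ) + N) / (n + N - 1) *
      ((n : ℝ) / (n + N) * sampleMean (fun i => f i ^ 2) +
        (N : ℝ) / (n + N) * sampleMean (fun i => u i ^ 2) -
        ((n : ℝ) / (n + N) * sampleMean f + (N : ℝ) / (n + N) * sampleMean u) ^ 2) := by
  have hn' : (0 : ℝ) < n := by exact_mod_cast hn
  have hN' : (0 : ℝ) < N := by exact_mod_cast hN
  have ep : pooledMean f u = (n : ℝ) / (n + N) * sampleMean f +
      (N : ℝ) / (n + N) * sampleMean u := by
    simp only [pooledMean, sampleMean]
    field_simp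
  have e : (∑ i, (f i - pooledMean f u) ^ 2) + ∑ i, (u i - pooledMean f u) ^ 2 =
      (∑ i, f i ^ 2) + (∑ i, u i ^ 2) - (n + N) * pooledMean f u ^ 2 := by
    have h : (∑ i, f i) + ∑ i, u i = (n + N) * pooledMean f u := by
      rw [pooledMean]; field_simp
    simp only [sub_sq, Finset.sum_add_distrib, Finset.sum_sub_distrib, ← Finset.sum_mul,
      ← Finset.mul_sum, Finset.sum_const, Finset.card_univ, Fintype.card_fin, nsmul_eq_mul]
    linear_combination (-2 * pooledMean f u) * h
  rw [pooledVar, e, ep]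
  have h3 : sampleMean (fun i => f i ^ 2) = (∑ i, f i ^ 2) / n := rfl
  have h4 : sampleMean (fun i => u i ^ 2) = (∑ i, u i ^ 2) / N := rfl
  rw [h3, h4, div_mul_eq_mul_div]
  field_simp

lemma tendsto_div_sub_one {x : α → ℝ} (hx : Tendsto x F atTop) :
    Tendsto (fun q => x q / (x q - 1)) F (𝓝 1) := by
  have h : Tendsto (fun q => 1 / (1 - (x q)⁻¹)) F (𝓝 (1 / (1 - 0))) :=
    tendsto_const_nhds.div (tendsto_const_nhds.sub hx.inv_tendsto_atTop) (by norm_num)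
  rw [sub_zero, div_one] at h
  refine h.congr' ?_
  filter_upwards [hx.eventually_gt_atTop 1] with q hq
  have h1 : x q ≠ 0 := by positivity
  have h2 : x q - 1 ≠ 0 := by linarith
  field_simp

variable {y f f' : ∀ q, Fin (n q) → ℝ} {u u' : ∀ q, Fin (N q) → ℝ}

/-- Consistency of the PPI++ coefficient when the control function is close in empirical mean
square to one whose sample moments converge. -/
lemma tendsto_lambdaHat {ρ ey ey2 ef ef2 eyf : ℝ} (hρ : 0 < ρ) (hn : Tendsto n F atTop)
    (hN : Tendsto N F atTop) (hnN : Tendsto (fun q => (n q : ℝ) / (N q : ℝ)) F (𝓝 ρ))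
    (hy : Tendsto (fun q => sampleMean (y q)) F (𝓝 ey))
    (hy2 : Tendsto (fun q => sampleMean fun i => y q i ^ 2) F (𝓝 ey2))
    (hf : Tendsto (fun q => sampleMean (f' q)) F (𝓝 ef))
    (hf2 : Tendsto (fun q => sampleMean fun i => f' q i ^ 2) F (𝓝 ef2))
    (hyf : Tendsto (fun q => sampleMean fun i => y q i * f' q i) F (𝓝 eyf))
    (hu : Tendsto (fun q => sampleMean (u' q)) F (𝓝 ef))
    (hu2 : Tendsto (fun q => sampleMean fun i => u' q i ^ 2) F (𝓝 ef2))
    (hdf : Tendsto (fun q => sampleMean fun i => (f q i - f' q i) ^ 2) F (𝓝 0))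
    (hdu : Tendsto (fun q => sampleMean fun i => (u q i - u' q i) ^ 2) F (𝓝 0))
    (hv : 0 < ef2 - ef ^ 2) :
    Tendsto (fun q => lambdaHat (y q) (f q) (u q)) F
      (𝓝 ((eyf - ey * ef) / ((1 + ρ) * (ef2 - ef ^ 2)))) := by
  have hnR : Tendsto (fun q => (n q : ℝ)) F atTop := tendsto_natCast_atTop_atTop.comp hn
  have hNR : Tendsto (fun q => (N q : ℝ)) F atTop := tendsto_natCast_atTop_atTop.comp hN
  have hρ1 : 1 + ρ ≠ 0 := by positivity
  have hwN : Tendsto (fun q => (N q : ℝ) / (n q + N q)) F (𝓝 (1 / (1 + ρ))) := by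
    have h : Tendsto (fun q => 1 / (1 + (n q : ℝ) / N q)) F (𝓝 (1 / (1 + ρ))) :=
      tendsto_const_nhds.div (tendsto_const_nhds.add hnN) hρ1
    refine h.congr' ?_
    filter_upwards [hN.eventually_gt_atTop 0] with q hq
    have : (0 : ℝ) < N q := by exact_mod_cast hq
    field_simp
    ring
  have hwn : Tendsto (fun q => (n q : ℝ) / (n q + N q)) F (𝓝 (1 - 1 / (1 + ρ))) := by
    refine (tendsto_const_nhds.sub hwN).congr' ?_
    filter_upwards [hN.eventually_gt_atTop 0] with q hq
    have : (0 : ℝ) < N q := by exact_mod_cast hq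
    field_simp
    ring
  have hcov : Tendsto (fun q => sampleCov (y q) (f q)) F (𝓝 (1 * (eyf - ey * ef))) := by
    refine ((tendsto_div_sub_one hnR).mul ((tendsto_sampleMean_mul_of_close hy2 hdf hyf).sub
      (hy.mul (tendsto_sampleMean_of_close hn hdf hf)))).congr' ?_
    filter_upwards [hn.eventually_gt_atTop 0] with q hq
    rw [sampleCov_eq hq]
  have hpv : Tendsto (fun q => pooledVar (f q) (u q)) F (𝓝 (1 * ((1 - 1 / (1 + ρ)) * ef2 +
      1 / (1 + ρ) * ef2 - ((1 - 1 / (1 + ρ)) * ef + 1 / (1 + ρ) * ef) ^ 2))) := by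
    refine ((tendsto_div_sub_one (hnR.atTop_add_atTop hNR)).mul
      (((hwn.mul (tendsto_sampleMean_sq_of_close hdf hf2)).add
        (hwN.mul (tendsto_sampleMean_sq_of_close hdu hu2))).sub
        (((hwn.mul (tendsto_sampleMean_of_close hn hdf hf)).add
          (hwN.mul (tendsto_sampleMean_of_close hN hdu hu))).pow 2))).congr' ?_
    filter_upwards [hn.eventually_gt_atTop 0, hN.eventually_gt_atTop 0] with q hq hq'
    rw [pooledVar_eq hq hq']
  -- Labeled and unlabeled moments share their limits and the pooling weights add up to one, so `ρ`
  -- drops out here; it enters the limit of `lambdaHat` only through the prefactor.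
  have e : 1 * ((1 - 1 / (1 + ρ)) * ef2 + 1 / (1 + ρ) * ef2 -
      ((1 - 1 / (1 + ρ)) * ef + 1 / (1 + ρ) * ef) ^ 2) = ef2 - ef ^ 2 := by ring
  rw [e] at hpv
  have e' : 1 / (1 + ρ) * (1 * (eyf - ey * ef) / (ef2 - ef ^ 2)) =
      (eyf - ey * ef) / ((1 + ρ) * (ef2 - ef ^ 2)) := by
    rw [one_mul, div_mul_div_comm, one_mul]
  rw [← e']
  exact hwN.mul (hcov.div hpv hv.ne')

/-- Asymptotic equivalence of PPI++ with the oracle. -/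
lemma tendsto_mul_ppiPlusPlus_sub {s : α → ℝ} {l : ℝ}
    (hl : Tendsto (fun q => lambdaHat (y q) (f q) (u q)) F (𝓝 l))
    (hb : BddAlong F fun q => s q * (sampleMean (f' q) - sampleMean (u' q)))
    (hd : Tendsto (fun q => s q * ((sampleMean (f q) - sampleMean (f' q)) -
      (sampleMean (u q) - sampleMean (u' q)))) F (𝓝 0)) :
    Tendsto (fun q => s q * (ppiPlusPlus (y q) (f q) (u q) - ppiWith l (y q) (f' q) (u' q))) F
      (𝓝 0) := by
  have h1 := hb (fun q => lambdaHat (y q) (f q) (u q) - l)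
    (by simpa using hl.sub_const l)
  -- The difference of the two estimates is minus `lambdaHat` times the contrast of the control
  -- errors, minus the coefficient error times the contrast of the limiting control.
  have h := ((hl.mul hd).add h1).neg
  rw [mul_zero, add_zero, neg_zero] at h
  refine h.congr fun q => ?_
  simp only [ppiPlusPlus, ppiWith]
  ring

end Along

/-! ### Linear control functions with perturbed coefficients and predictions -/

section Linear

variable {p : ℕ}

/-- The prediction occupies coordinate `1` only. Split in this way, the coefficient error meets the
limiting features, which are i.i.d. along each row, and the prediction error meets one fitted
coefficient. -/
lemma linPred_sub_linPred (b β : Coef p) (yh g : ℝ) (x : EuclideanSpace ℝ (Fin p)) :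
    linPred b (feature yh x) - linPred β (feature g x) =
      (∑ c, (b c - β c) * feature g x c) + b 1 * (yh - g) := by
  have e : ∀ c, feature yh x c = feature g x c + if c = 1 then yh - g else 0 := by
    intro c
    refine Fin.cases ?_ (fun c => Fin.cases ?_ (fun c => ?_) c) c
    · simp [feature]
    · simp [feature]
    · have : (c.succ.succ : Fin (p + 2)) ≠ 1 := by
        intro h
        have := congrArg Fin.val h
        simp at this
      simp [feature, this]
  simp only [linPred, e, mul_add, Finset.sum_add_distrib, sub_mul, Finset.sum_sub_distrib]
  simp
  ring

lemma linPred_sub_sq_le (b β : Coef p) (yh g : ℝ) (x : EuclideanSpace ℝ (Fin p)) :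
    (linPred b (feature yh x) - linPred β (feature g x)) ^ 2 ≤
      2 * (∑ c, (b c - β c) ^ 2) * (∑ c, feature g x c ^ 2) + 2 * b 1 ^ 2 * (yh - g) ^ 2 := by
  rw [linPred_sub_linPred]
  have h := Finset.sum_mul_sq_le_sq_mul_sq Finset.univ (fun c => b c - β c)
    (fun c => feature g x c)
  -- The hint is the square behind `(s + t)² ≤ 2s² + 2t²`.
  nlinarith [sq_nonneg ((∑ c, (b c - β c) * feature g x c) - b 1 * (yh - g))]

variable {α : Type*} {F : Filter α} {n N : α → ℕ} {b : α → Coef p} {β : Coef p}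
  {yh g : ∀ q, Fin (n q) → ℝ} {x : ∀ q, Fin (n q) → EuclideanSpace ℝ (Fin p)}
  {yh' g' : ∀ q, Fin (N q) → ℝ} {x' : ∀ q, Fin (N q) → EuclideanSpace ℝ (Fin p)}

lemma tendsto_coord (hb : Tendsto b F (𝓝 β)) (c : Fin (p + 2)) :
    Tendsto (fun q => b q c) F (𝓝 (β c)) := by
  have h : Continuous fun z : Coef p => z c := by fun_prop
  exact (h.tendsto β).comp hb

lemma tendsto_sampleMean_linPred_sub_sq (hb : Tendsto b F (𝓝 β)) {v : Fin (p + 2) → ℝ}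
    (hz : ∀ c, Tendsto (fun q => sampleMean fun i => feature (g q i) (x q i) c ^ 2) F (𝓝 (v c)))
    (he : Tendsto (fun q => sampleMean fun i => (yh q i - g q i) ^ 2) F (𝓝 0)) :
    Tendsto (fun q => sampleMean fun i => (linPred (b q) (feature (yh q i) (x q i)) -
      linPred β (feature (g q i) (x q i))) ^ 2) F (𝓝 0) := by
  have h1 : Tendsto (fun q => ∑ c, (b q c - β c) ^ 2) F (𝓝 0) := by
    have := tendsto_finsetSum (Finset.univ : Finset (Fin (p + 2))) fun c _ =>
      ((tendsto_coord hb c).sub_const (β c)).pow 2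
    simpa using this
  have h2 := tendsto_finsetSum (Finset.univ : Finset (Fin (p + 2))) fun c _ => hz c
  have h := ((h1.const_mul 2).mul h2).add ((((tendsto_coord hb 1).pow 2).const_mul 2).mul he)
  rw [mul_zero, mul_zero, zero_mul, add_zero] at h
  refine squeeze_zero (fun q => sampleMean_nonneg fun i => sq_nonneg _) (fun q => ?_) h
  refine (sampleMean_mono fun i => linPred_sub_sq_le _ _ _ _ _).trans (le_of_eq ?_)
  rw [sampleMean_add, sampleMean_const_mul, sampleMean_const_mul, sampleMean_sum]

/-- No rate for the coefficients is needed: their error multiplies a contrast of feature means that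
is bounded even after scaling by `s`. -/
lemma tendsto_mul_sampleMean_linPred_sub {s : α → ℝ} (hb : Tendsto b F (𝓝 β))
    (hz : ∀ c, BddAlong F fun q => s q * (sampleMean (fun i => feature (g q i) (x q i) c) -
      sampleMean (fun i => feature (g' q i) (x' q i) c)))
    (he : Tendsto (fun q => s q * (sampleMean (fun i => yh q i - g q i) -
      sampleMean (fun i => yh' q i - g' q i))) F (𝓝 0)) :
    Tendsto (fun q => s q *
      ((sampleMean (fun i => linPred (b q) (feature (yh q i) (x q i))) -
          sampleMean (fun i => linPred β (feature (g q i) (x q i)))) -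
        (sampleMean (fun i => linPred (b q) (feature (yh' q i) (x' q i))) -
          sampleMean (fun i => linPred β (feature (g' q i) (x' q i)))))) F (𝓝 0) := by
  have h1 := tendsto_finsetSum (Finset.univ : Finset (Fin (p + 2))) fun c _ =>
    hz c (fun q => b q c - β c) (by simpa using (tendsto_coord hb c).sub_const (β c))
  have h := h1.add ((tendsto_coord hb 1).mul he)
  simp only [Finset.sum_const_zero, mul_zero, add_zero] at h
  refine h.congr fun q => ?_
  rw [← sampleMean_sub, ← sampleMean_sub]
  simp only [linPred_sub_linPred]
  rw [sampleMean_add, sampleMean_add, sampleMean_const_mul, sampleMean_const_mul, sampleMean_sum,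
    sampleMean_sum]
  simp only [sampleMean_const_mul]
  have e : ∀ c, (b q c - β c) * (s q * (sampleMean (fun i => feature (g q i) (x q i) c) -
      sampleMean (fun i => feature (g' q i) (x' q i) c))) =
      s q * ((b q c - β c) * sampleMean (fun i => feature (g q i) (x q i) c)) -
      s q * ((b q c - β c) * sampleMean (fun i => feature (g' q i) (x' q i) c)) := by
    intro c; ring
  simp only [e, Finset.sum_sub_distrib, ← Finset.mul_sum]
  ring

end Linear

/-! ### Measurability and moments of the features and the estimates -/

section Features

variable {Ω 𝒱 : Type*} [MeasurableSpace Ω] [MeasurableSpace 𝒱] {p : ℕ} {μ : Measure Ω}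
  {yh : Ω → ℝ} {x : Ω → EuclideanSpace ℝ (Fin p)}

lemma measurable_feature (hy : Measurable yh) (hx : Measurable x) (c : Fin (p + 2)) :
    Measurable fun ω => feature (yh ω) (x ω) c := by
  refine Fin.cases ?_ (fun c => Fin.cases ?_ (fun c => ?_) c) c
  · simp [feature]
  · simpa [feature] using hy
  · simp only [feature, Matrix.cons_val_succ]
    fun_prop

lemma measurable_linPred {b z : Ω → Coef p} (hb : Measurable b)
    (hz : ∀ c, Measurable fun ω => z ω c) : Measurable fun ω => linPred (b ω) (z ω) := by
  unfold linPred
  refine Finset.measurable_sum _ fun c _ => Measurable.mul ?_ (hz c)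
  fun_prop

lemma memLp_feature [IsFiniteMeasure μ] (hy : MemLp yh 2 μ) (hx : MemLp x 2 μ) (c : Fin (p + 2)) :
    MemLp (fun ω => feature (yh ω) (x ω) c) 2 μ := by
  refine Fin.cases ?_ (fun c => Fin.cases ?_ (fun c => ?_) c) c
  · simpa [feature] using memLp_const (1 : ℝ)
  · simpa [feature] using hy
  · simp only [feature, Matrix.cons_val_succ]
    exact (EuclideanSpace.proj (𝕜 := ℝ) c).comp_memLp' hx

lemma memLp_linPred {b : Coef p} {z : Ω → Coef p} (hz : ∀ c, MemLp (fun ω => z ω c) 2 μ) :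
    MemLp (fun ω => linPred b (z ω)) 2 μ := by
  unfold linPred
  exact memLp_finsetSum _ fun c _ => (hz c).const_mul (b c)

lemma measurable_fStar {g : 𝒱 → ℝ} (hg : Measurable g) (β : Coef p) : Measurable (fStar g β) :=
  measurable_linPred measurable_const
    (measurable_feature (hg.comp measurable_fst) measurable_snd)

lemma measurable_sampleMean {n : ℕ} {a : Ω → Fin n → ℝ} (ha : ∀ i, Measurable fun ω => a ω i) :
    Measurable fun ω => sampleMean (a ω) := by
  unfold sampleMean
  exact (Finset.measurable_sum _ fun i _ => ha i).div_const _

lemma measurable_ppiPlusPlus {n N : ℕ} {y f : Ω → Fin n → ℝ} {u : Ω → Fin N → ℝ}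
    (hy : ∀ i, Measurable fun ω => y ω i) (hf : ∀ i, Measurable fun ω => f ω i)
    (hu : ∀ i, Measurable fun ω => u ω i) :
    Measurable fun ω => ppiPlusPlus (y ω) (f ω) (u ω) := by
  have my := measurable_sampleMean hy
  have mf := measurable_sampleMean hf
  have mu := measurable_sampleMean hu
  have hcov : Measurable fun ω => sampleCov (y ω) (f ω) := by
    unfold sampleCov
    exact (Finset.measurable_sum _ fun i _ => ((hy i).sub my).mul ((hf i).sub mf)).div_const _
  have hpm : Measurable fun ω => pooledMean (f ω) (u ω) := by
    unfold pooledMean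
    exact ((Finset.measurable_sum _ fun i _ => hf i).add
      (Finset.measurable_sum _ fun i _ => hu i)).div_const _
  have hpv : Measurable fun ω => pooledVar (f ω) (u ω) := by
    unfold pooledVar
    exact ((Finset.measurable_sum _ fun i _ => ((hf i).sub hpm).pow_const 2).add
      (Finset.measurable_sum _ fun i _ => ((hu i).sub hpm).pow_const 2)).div_const _
  unfold ppiPlusPlus ppiWith lambdaHat
  exact my.sub ((measurable_const.mul (hcov.div hpv)).mul (mf.sub mu))

end Features

namespace Run

variable {J R K p : ℕ} {𝒱 𝒰 Ω : Type*} [MeasurableSpace 𝒱] [MeasurableSpace 𝒰]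
  [MeasurableSpace Ω] {S : Run J R K p 𝒱 𝒰 Ω} {P : Fin J → Measure (Labeled 𝒱 p)}
  {Pr : Measure Ω}

lemma IsSample.measurable_ghat (hs : S.IsSample P Pr) (hv : S.IsValid) (k : Fin K) {v : Ω → 𝒱}
    (h : Measurable v) : Measurable fun ω => S.ghat k ω (v ω) :=
  (hv.measurable_train k).comp (hs.measurable_aux.prodMk (hs.measurable_labData.prodMk h))

lemma IsSample.measurable_yhatLab (hs : S.IsSample P Pr) (hv : S.IsValid) (j : Fin J)
    (i : Fin (S.n j)) : Measurable fun ω => S.yhatLab j ω i := by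
  have e : ∀ ω, S.yhatLab j ω i =
      ∑ k, if S.fold (S.aux ω) j i = k then S.ghat k ω (S.lab j i ω).2.1 else 0 := by
    intro ω
    simp [yhatLab]
  simp_rw [e]
  refine Finset.measurable_sum _ fun k _ => Measurable.ite ?_
    (hs.measurable_ghat hv k (measurable_photo.comp (hs.measurable_lab j i))) measurable_const
  exact (hv.measurableSet_fold j i k).preimage hs.measurable_aux

lemma IsSample.measurable_yhatUnl (hs : S.IsSample P Pr) (hv : S.IsValid) (j : Fin J)
    (i : Fin (S.N j)) : Measurable fun ω => S.yhatUnl j ω i := by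
  unfold yhatUnl
  exact (Finset.measurable_sum _ fun k _ =>
    hs.measurable_ghat hv k (measurable_fst.comp (hs.measurable_unl j i))).div_const _

lemma IsSample.measurable_estimate (hs : S.IsSample P Pr) (hv : S.IsValid) (j : Fin J) :
    Measurable (S.estimate j) := by
  refine measurable_ppiPlusPlus (fun i => measurable_fst.comp (hs.measurable_lab j i))
    (fun i => measurable_linPred (hv.measurable_betaHat _) (measurable_feature
      (hs.measurable_yhatLab hv j i) (measurable_snd.snd.comp (hs.measurable_lab j i))))
    (fun i => measurable_linPred (hv.measurable_betaHat _) (measurable_feature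
      (hs.measurable_yhatUnl hv j i) (measurable_snd.comp (hs.measurable_unl j i))))

lemma IsSample.iIndepFun_lab (hs : S.IsSample P Pr) (j : Fin J) : iIndepFun (S.lab j) Pr :=
  hs.indep_lab.precomp (g := fun i : Fin (S.n j) => (⟨j, i⟩ : Σ j, Fin (S.n j)))
    (sigma_mk_injective (β := fun j => Fin (S.n j)) (i := j))

end Run

/-! ### Limit theorems for one zone -/

/-- The standardized difference of a labeled and an unlabeled mean. -/
lemma sqrt_mul_sampleMean_sub_sampleMean {n N : ℕ} (hn : 0 < n) (hN : 0 < N) (a : Fin n → ℝ)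
    (b : Fin N → ℝ) (d e : ℝ) :
    √n * (sampleMean a + sampleMean b - (d + e)) = (√n)⁻¹ * (∑ i, a i - n * d) +
      √((n : ℝ) / N) * ((√N)⁻¹ * (∑ i, b i - N * e)) := by
  have hn' : (0 : ℝ) < n := by exact_mod_cast hn
  have hN' : (0 : ℝ) < N := by exact_mod_cast hN
  rw [Real.sqrt_div hn'.le, sampleMean, sampleMean]
  obtain ⟨s, hs, hs'⟩ : ∃ s : ℝ, 0 < s ∧ (n : ℝ) = s ^ 2 :=
    ⟨√n, by positivity, (Real.sq_sqrt hn'.le).symm⟩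
  obtain ⟨t, ht, ht'⟩ : ∃ t : ℝ, 0 < t ∧ (N : ℝ) = t ^ 2 :=
    ⟨√N, by positivity, (Real.sq_sqrt hN'.le).symm⟩
  rw [hs', ht', Real.sqrt_sq hs.le, Real.sqrt_sq ht.le]
  field_simp
  ring

/-- Slutsky's theorem. -/
lemma tendstoInDistribution_of_tendsto_sub {Ω : Type*} [MeasurableSpace Ω] {Pr : Measure Ω}
    [IsProbabilityMeasure Pr] {X Y : ℕ → Ω → ℝ} {ν : Measure ℝ} [IsProbabilityMeasure ν]
    (hX : TendstoInDistribution X atTop (id : ℝ → ℝ) (fun _ => Pr) ν) (hY : ∀ m, Measurable (Y m))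
    (h : Tendsto (fun q : ℕ × Ω => Y q.1 q.2 - X q.1 q.2) (inProb Pr) (𝓝 0)) :
    TendstoInDistribution Y atTop (id : ℝ → ℝ) (fun _ => Pr) ν :=
  tendstoInDistribution_of_tendstoInMeasure_sub Y id hX
    ((tendstoInMeasure_const_iff (X := fun m ω => Y m ω - X m ω)).2 h) fun m => (hY m).aemeasurable

section Zone

variable {J R K p : ℕ} {𝒱 𝒰 Ω : Type*} [MeasurableSpace 𝒱]
  [MeasurableSpace Ω] {Pr : Measure Ω} {P : Fin J → Measure (Labeled 𝒱 p)}
  {S : ℕ → Run J R K p 𝒱 𝒰 Ω} {j : Fin J}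

lemma tendsto_sqDist {g : 𝒱 → ℝ} {k : Fin K} (h : ∀ ε : ENNReal, 0 < ε → Tendsto
      (fun m => Pr {ω | ε ≤ eLpNorm (fun z => (S m).ghat k ω z.2.1 - g z.2.1) 2 (P j)})
      atTop (𝓝 0)) :
    Tendsto (fun q : ℕ × Ω => sqDist (P j) g ((S q.1).ghat k q.2)) (inProb Pr) (𝓝 0) := by
  rw [ENNReal.tendsto_nhds_zero]
  intro ε hε
  -- `sqDist` is the square of the `eLpNorm`, so the hypothesis is applied at the square root of
  -- `ε`.
  have hε' : 0 < ε ^ (1 / 2 : ℝ) := by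
    rw [pos_iff_ne_zero]
    simpa using hε.ne'
  rw [eventually_inProb]
  refine tendsto_of_tendsto_of_tendsto_of_le_of_le tendsto_const_nhds (h _ hε')
    (fun _ => zero_le) (fun m => measure_mono fun ω hω => ?_)
  by_contra hc
  simp only [Set.mem_ofPred_eq, not_le] at hω hc
  refine absurd hω (not_lt.2 ?_)
  have e := eLpNorm_nnreal_pow_eq_lintegral (μ := P j)
    (f := fun z : Labeled 𝒱 p => (S m).ghat k ω z.2.1 - g z.2.1) (p := 2) (by norm_num)
  simp only [NNReal.coe_ofNat, ENNReal.coe_ofNat, ENNReal.rpow_ofNat] at e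
  unfold sqDist
  rw [← e]
  calc _ ≤ (ε ^ (1 / 2 : ℝ)) ^ 2 := by gcongr
    _ = ε := by
      rw [← ENNReal.rpow_natCast, ← ENNReal.rpow_mul]
      norm_num

variable [MeasurableSpace 𝒰] [IsProbabilityMeasure Pr] [∀ j, IsProbabilityMeasure (P j)] {ρ : ℝ}

lemma tendsto_sampleMean_lab (hsample : ∀ m, (S m).IsSample P Pr)
    (hn : Tendsto (fun m => (S m).n j) atTop atTop) {h : Labeled 𝒱 p → ℝ} (hh : Measurable h)
    (hint : Integrable h (P j)) :
    Tendsto (fun q : ℕ × Ω => sampleMean fun i => h ((S q.1).lab j i q.2)) (inProb Pr)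
      (𝓝 (∫ z, h z ∂(P j))) :=
  tendsto_sampleMean_row hn (fun m i => (hsample m).measurable_lab j i)
    (fun m i => (hsample m).law_lab j i) (fun m => (hsample m).iIndepFun_lab j) hh hint

lemma tendsto_sampleMean_unl (hsample : ∀ m, (S m).IsSample P Pr)
    (hN : Tendsto (fun m => (S m).N j) atTop atTop) {h : Unlabeled 𝒱 p → ℝ} (hh : Measurable h)
    (hint : Integrable (fun z => h z.2) (P j)) :
    Tendsto (fun q : ℕ × Ω => sampleMean fun i => h ((S q.1).unl j i q.2)) (inProb Pr)
      (𝓝 (∫ z, h z.2 ∂(P j))) := by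
  have : IsProbabilityMeasure ((P j).map Prod.snd) :=
    Measure.isProbabilityMeasure_map measurable_snd.aemeasurable
  rw [← integral_map measurable_snd.aemeasurable hh.aestronglyMeasurable]
  exact tendsto_sampleMean_row hN (fun m i => (hsample m).measurable_unl j i)
    (fun m i => (hsample m).law_unl j i) (fun m => (hsample m).indep_unl j) hh
    ((integrable_map_measure hh.aestronglyMeasurable measurable_snd.aemeasurable).2 hint)

lemma bddAlong_lab (hsample : ∀ m, (S m).IsSample P Pr) {h : Labeled 𝒱 p → ℝ} (hh : Measurable h)
    (hL2 : MemLp h 2 (P j)) :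
    BddAlong (inProb Pr) fun q => (√((S q.1).n j))⁻¹ *
      (∑ i, h ((S q.1).lab j i q.2) - (S q.1).n j * ∫ z, h z ∂(P j)) :=
  bddAlong_of_sqMomentLe (X := fun m ω => (√((S m).n j))⁻¹ *
      (∑ i, h ((S m).lab j i ω) - (S m).n j * ∫ z, h z ∂(P j))) <| Eventually.of_forall <|
    sqMomentLe_row (fun m i => (hsample m).measurable_lab j i)
      (fun m i => (hsample m).law_lab j i) (fun m => (hsample m).iIndepFun_lab j) hh hL2

lemma bddAlong_unl (hsample : ∀ m, (S m).IsSample P Pr) {h : Unlabeled 𝒱 p → ℝ}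
    (hh : Measurable h) (hL2 : MemLp (fun z => h z.2) 2 (P j)) :
    BddAlong (inProb Pr) fun q => (√((S q.1).N j))⁻¹ *
      (∑ i, h ((S q.1).unl j i q.2) - (S q.1).N j * ∫ z, h z.2 ∂(P j)) := by
  have : IsProbabilityMeasure ((P j).map Prod.snd) :=
    Measure.isProbabilityMeasure_map measurable_snd.aemeasurable
  rw [← integral_map measurable_snd.aemeasurable hh.aestronglyMeasurable]
  exact bddAlong_of_sqMomentLe (X := fun m ω => (√((S m).N j))⁻¹ *
      (∑ i, h ((S m).unl j i ω) - (S m).N j * ∫ z, h z ∂((P j).map Prod.snd))) <|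
    Eventually.of_forall <|
    sqMomentLe_row (fun m i => (hsample m).measurable_unl j i)
      (fun m i => (hsample m).law_unl j i) (fun m => (hsample m).indep_unl j) hh
      ((memLp_map_measure_iff hh.aestronglyMeasurable measurable_snd.aemeasurable).2 hL2)

lemma bddAlong_sampleMean_sub (hsample : ∀ m, (S m).IsSample P Pr)
    (hn : Tendsto (fun m => (S m).n j) atTop atTop) (hN : Tendsto (fun m => (S m).N j) atTop atTop)
    (hnN : Tendsto (fun m => ((S m).n j : ℝ) / ((S m).N j : ℝ)) atTop (𝓝 ρ))
    {h : Unlabeled 𝒱 p → ℝ} (hh : Measurable h) (hL2 : MemLp (fun z => h z.2) 2 (P j)) :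
    BddAlong (inProb Pr) fun q => √((S q.1).n j) *
      (sampleMean (fun i => h ((S q.1).lab j i q.2).2) -
        sampleMean (fun i => h ((S q.1).unl j i q.2))) := by
  intro T hT
  have h1 := ((bddAlong_lab hsample (h := fun z => h z.2) (hh.comp measurable_snd) hL2).sub
    ((bddAlong_unl hsample hh hL2).mul_of_tendsto
      (hnN.sqrt.comp (tendsto_fst_inProb (Pr := Pr))))) T hT
  refine h1.congr' ?_
  filter_upwards [tendsto_fst_inProb.eventually (hn.eventually_gt_atTop 0),
    tendsto_fst_inProb.eventually (hN.eventually_gt_atTop 0)] with q hq hq'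
  -- Negating the unlabeled values makes the centerings cancel, because `h` has the same mean on
  -- both kinds of fields.
  have e := sqrt_mul_sampleMean_sub_sampleMean hq hq' (fun i => h ((S q.1).lab j i q.2).2)
    (fun i => -h ((S q.1).unl j i q.2)) (∫ z, h z.2 ∂(P j)) (-∫ z, h z.2 ∂(P j))
  have e2 : sampleMean (fun i => -h ((S q.1).unl j i q.2)) =
      -sampleMean (fun i => h ((S q.1).unl j i q.2)) := by
    simp [sampleMean, neg_div]
  rw [e2, Finset.sum_neg_distrib, add_neg_cancel, sub_zero, ← sub_eq_add_neg] at e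
  rw [e]
  simp only [Function.comp_apply]
  ring

/-- Gaussian limit for the leading term of the oracle estimate. -/
lemma tendstoInDistribution_leading (hsample : ∀ m, (S m).IsSample P Pr)
    (hn : Tendsto (fun m => (S m).n j) atTop atTop) (hN : Tendsto (fun m => (S m).N j) atTop atTop)
    {h : Labeled 𝒱 p → ℝ} (hh : Measurable h) (hL2 : MemLp h 2 (P j))
    {f : Unlabeled 𝒱 p → ℝ} (hf : Measurable f) (hf2 : MemLp (fun z => f z.2) 2 (P j)) (a : ℝ) :
    TendstoInDistribution (fun m ω =>
      (√((S m).n j))⁻¹ * (∑ i, h ((S m).lab j i ω) - (S m).n j * ∫ z, h z ∂(P j)) +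
      a * ((√((S m).N j))⁻¹ * (∑ i, f ((S m).unl j i ω) - (S m).N j * ∫ z, f z.2 ∂(P j)))) atTop
      (id : ℝ → ℝ) (fun _ => Pr)
      (gaussianReal 0 (variance h (P j) + a ^ 2 * varControl (P j) f).toNNReal) := by
  have : IsProbabilityMeasure ((P j).map Prod.snd) :=
    Measure.isProbabilityMeasure_map measurable_snd.aemeasurable
  have e : varControl (P j) f = variance f ((P j).map Prod.snd) := by
    rw [variance_map hf.aemeasurable measurable_snd.aemeasurable]
    rfl
  rw [e, ← integral_map measurable_snd.aemeasurable hf.aestronglyMeasurable]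
  refine tendstoInDistribution_add_const_mul (fun m => ?_) (fun m => ?_) (fun m => ?_)
    (variance_nonneg _ _) (variance_nonneg _ _)
    (tendsto_charFun_row hn (fun m i => (hsample m).measurable_lab j i)
      (fun m i => (hsample m).law_lab j i) (fun m => (hsample m).iIndepFun_lab j) hh hL2)
    (tendsto_charFun_row hN (fun m i => (hsample m).measurable_unl j i)
      (fun m i => (hsample m).law_unl j i) (fun m => (hsample m).indep_unl j) hf
      ((memLp_map_measure_iff hf.aestronglyMeasurable measurable_snd.aemeasurable).2 hf2)) a
  · exact ((Finset.measurable_sum _ fun i _ => hh.comp ((hsample m).measurable_lab j i)).sub_const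
      _).const_mul _
  · exact ((Finset.measurable_sum _ fun i _ => hf.comp ((hsample m).measurable_unl j i)).sub_const
      _).const_mul _
  · have hφ : Measurable fun d : (j : Fin J) → Fin ((S m).n j) → Labeled 𝒱 p =>
        (√((S m).n j))⁻¹ * (∑ i, h (d j i) - (S m).n j * ∫ z, h z ∂(P j)) := by
      have hp : ∀ i, Measurable fun d : (j : Fin J) → Fin ((S m).n j) → Labeled 𝒱 p => d j i :=
        fun i => (measurable_pi_apply i).comp (measurable_pi_apply j)
      exact ((Finset.measurable_sum _ fun i _ => hh.comp (hp i)).sub_const _).const_mul _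
    have hψ : Measurable fun d : (j : Fin J) → Fin ((S m).N j) → Unlabeled 𝒱 p =>
        (√((S m).N j))⁻¹ * (∑ i, f (d j i) - (S m).N j * ∫ z, f z ∂((P j).map Prod.snd)) := by
      have hp : ∀ i, Measurable fun d : (j : Fin J) → Fin ((S m).N j) → Unlabeled 𝒱 p => d j i :=
        fun i => (measurable_pi_apply i).comp (measurable_pi_apply j)
      exact ((Finset.measurable_sum _ fun i _ => hf.comp (hp i)).sub_const _).const_mul _
    exact (hsample m).indep_lab_unl.comp hφ hψ

/-- The oracle estimate is asymptotically its leading term. -/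
lemma tendsto_oracle_sub_leading (hsample : ∀ m, (S m).IsSample P Pr)
    (hn : Tendsto (fun m => (S m).n j) atTop atTop) (hN : Tendsto (fun m => (S m).N j) atTop atTop)
    (hnN : Tendsto (fun m => ((S m).n j : ℝ) / ((S m).N j : ℝ)) atTop (𝓝 ρ))
    (hY : Integrable (fun z => z.1) (P j)) {f : Unlabeled 𝒱 p → ℝ} (hf : Measurable f)
    (hf2 : MemLp (fun z => f z.2) 2 (P j)) (l : ℝ) :
    Tendsto (fun q : ℕ × Ω => √((S q.1).n j) * ((S q.1).oracle f l j q.2 - theta (P j)) -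
      ((√((S q.1).n j))⁻¹ * (∑ i, (((S q.1).lab j i q.2).1 - l * f ((S q.1).lab j i q.2).2) -
        (S q.1).n j * ∫ z, (z.1 - l * f z.2) ∂(P j)) +
      l * √ρ * ((√((S q.1).N j))⁻¹ * (∑ i, f ((S q.1).unl j i q.2) -
        (S q.1).N j * ∫ z, f z.2 ∂(P j))))) (inProb Pr) (𝓝 0) := by
  -- The exact coefficient of the unlabeled sum is `l * √(n / N)`; replacing it by `l * √ρ` is the
  -- only error.
  have h1 := bddAlong_unl hsample hf hf2
    (fun q => l * (√(((S q.1).n j : ℝ) / ((S q.1).N j : ℝ)) - √ρ)) (by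
      have := ((hnN.sqrt.comp (tendsto_fst_inProb (Pr := Pr))).sub_const (√ρ)).const_mul l
      simpa using this)
  refine h1.congr' ?_
  filter_upwards [tendsto_fst_inProb.eventually (hn.eventually_gt_atTop 0),
    tendsto_fst_inProb.eventually (hN.eventually_gt_atTop 0)] with q hq hq'
  have e := sqrt_mul_sampleMean_sub_sampleMean hq hq'
    (fun i => ((S q.1).lab j i q.2).1 - l * f ((S q.1).lab j i q.2).2)
    (fun i => l * f ((S q.1).unl j i q.2)) (∫ z, (z.1 - l * f z.2) ∂(P j))
    (l * ∫ z, f z.2 ∂(P j))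
  have e2 : (S q.1).oracle f l j q.2 =
      sampleMean (fun i => ((S q.1).lab j i q.2).1 - l * f ((S q.1).lab j i q.2).2) +
      sampleMean (fun i => l * f ((S q.1).unl j i q.2)) := by
    rw [sampleMean_sub, sampleMean_const_mul, sampleMean_const_mul]
    simp only [Run.oracle, ppiWith]
    change sampleMean (fun i => ((S q.1).lab j i q.2).1) - _ = _
    ring
  have e3 : theta (P j) = (∫ z, (z.1 - l * f z.2) ∂(P j)) + l * ∫ z, f z.2 ∂(P j) := by
    rw [integral_sub hY ((hf2.integrable (by norm_num)).const_mul l), integral_const_mul, theta]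
    ring
  rw [e2, e3, e, ← Finset.mul_sum]
  ring

end Zone

end PPI

/-! ### Proof of the theorem -/

theorem theorem1 {J R K p : ℕ} (hK : 0 < K)
    {𝒱 𝒰 Ω : Type*} [MeasurableSpace 𝒱] [MeasurableSpace 𝒰] [MeasurableSpace Ω]
    (Pr : Measure Ω) [IsProbabilityMeasure Pr]
    -- the law of a labeled field in each zone, with square integrable `Y` and `X`
    (P : Fin J → Measure (PPI.Labeled 𝒱 p)) [∀ j, IsProbabilityMeasure (P j)]
    (hY : ∀ j, MemLp (fun z => z.1) 2 (P j))
    (hX : ∀ j, MemLp (fun z => z.2.2) 2 (P j))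
    -- a sequence of runs of the procedure with a fixed assignment of zones to study regions
    (r : Fin J → Fin R) (S : ℕ → PPI.Run J R K p 𝒱 𝒰 Ω)
    (hr : ∀ m, (S m).region = r)
    (hvalid : ∀ m, (S m).IsValid)
    (hsample : ∀ m, (S m).IsSample P Pr)
    -- growing sample sizes
    (ρ : Fin J → ℝ) (hρ : ∀ j, 0 < ρ j)
    (hN : ∀ j, Tendsto (fun m => (S m).N j) atTop atTop)
    (hnN : ∀ j, Tendsto (fun m => ((S m).n j : ℝ) / ((S m).N j : ℝ)) atTop (𝓝 (ρ j)))
    -- the photo models converge in mean square to a common square integrable `g`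
    (g : 𝒱 → ℝ) (hg : Measurable g) (hg2 : ∀ j, MemLp (fun z => g z.2.1) 2 (P j))
    (hghat : ∀ j k, ∀ ε : ENNReal, 0 < ε → Tendsto
      (fun m => Pr {ω | ε ≤ eLpNorm (fun z => (S m).ghat k ω z.2.1 - g z.2.1) 2 (P j)})
      atTop (𝓝 0))
    -- the LASSO coefficients converge in probability
    (β : Fin R → PPI.Coef p)
    (hβ : ∀ j, TendstoInMeasure Pr (fun m => (S m).betaHat (r j)) atTop (fun _ => β (r j)))
    -- any zone in which the limiting control function is not degenerate
    (j : Fin J) (hvar : 0 < PPI.varControl (P j) (PPI.fStar g (β (r j)))) :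
    -- asymptotic normality
    TendstoInDistribution
      (fun m ω => √((S m).n j : ℝ) * ((S m).estimate j ω - PPI.theta (P j))) atTop
      (id : ℝ → ℝ) (fun _ => Pr)
      (gaussianReal 0 (PPI.asympVar (P j) (PPI.fStar g (β (r j))) (ρ j)).toNNReal) ∧
    -- consistency of the coefficient
    TendstoInMeasure Pr (fun m => (S m).lambda j) atTop
      (fun _ => PPI.lambdaStar (P j) (PPI.fStar g (β (r j))) (ρ j)) ∧
    -- asymptotic equivalence with the oracle
    TendstoInMeasure Pr
      (fun m ω => √((S m).n j : ℝ) * ((S m).estimate j ω -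
        (S m).oracle (PPI.fStar g (β (r j)))
          (PPI.lambdaStar (P j) (PPI.fStar g (β (r j))) (ρ j)) j ω)) atTop (fun _ => 0) := by
  generalize hf_def : PPI.fStar g (β (r j)) = f at hvar ⊢
  generalize hl_def : PPI.lambdaStar (P j) f (ρ j) = l
  have hn := PPI.tendsto_of_ratio (hρ j) (hN j) (hnN j)
  have hd := fun k => PPI.tendsto_sqDist (hghat j k)
  have hb : Tendsto (fun q : ℕ × Ω => (S q.1).betaHat (r j) q.2) (PPI.inProb Pr) (𝓝 (β (r j))) :=
    (PPI.tendstoInMeasure_const_iff (E := PPI.Coef p) (X := fun m => (S m).betaHat (r j))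
      (c := β (r j))).1 (hβ j)
  -- the features of the limiting control function
  have hzm : ∀ c, Measurable fun w : PPI.Unlabeled 𝒱 p => PPI.feature (g w.1) w.2 c :=
    PPI.measurable_feature (yh := fun w : PPI.Unlabeled 𝒱 p => g w.1) (x := fun w => w.2)
      (hg.comp measurable_fst) measurable_snd
  have hz2 : ∀ c, MemLp (fun z : PPI.Labeled 𝒱 p => PPI.feature (g z.2.1) z.2.2 c) 2 (P j) :=
    PPI.memLp_feature (yh := fun z : PPI.Labeled 𝒱 p => g z.2.1) (x := fun z => z.2.2)
      (hg2 j) (hX j)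
  have hfm : Measurable f := hf_def ▸ PPI.measurable_fStar hg _
  have hf2 : MemLp (fun z : PPI.Labeled 𝒱 p => f z.2) 2 (P j) := by
    subst hf_def
    exact PPI.memLp_linPred hz2
  have hYi : Integrable (fun z : PPI.Labeled 𝒱 p => z.1) (P j) := (hY j).integrable (by norm_num)
  have hfi : Integrable (fun z : PPI.Labeled 𝒱 p => f z.2) (P j) := hf2.integrable (by norm_num)
  have hfLab : ∀ m ω, (S m).fLab j ω = fun i => PPI.linPred ((S m).betaHat (r j) ω)
      (PPI.feature ((S m).yhatLab j ω i) ((S m).lab j i ω).2.2) := by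
    intro m ω
    funext i
    simp only [PPI.Run.fLab, PPI.Run.featLab, hr]
  have hfUnl : ∀ m ω, (S m).fUnl j ω = fun i => PPI.linPred ((S m).betaHat (r j) ω)
      (PPI.feature ((S m).yhatUnl j ω i) ((S m).unl j i ω).2) := by
    intro m ω
    funext i
    simp only [PPI.Run.fUnl, PPI.Run.featUnl, hr]
  -- the learned control function is close to its limit
  have hdf : Tendsto (fun q : ℕ × Ω => PPI.sampleMean fun i =>
      ((S q.1).fLab j q.2 i - f ((S q.1).lab j i q.2).2) ^ 2) (PPI.inProb Pr) (𝓝 0) := by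
    simp only [hfLab, ← hf_def]
    exact PPI.tendsto_sampleMean_linPred_sub_sq hb
      (fun c => PPI.tendsto_sampleMean_lab hsample hn
        (h := fun z => PPI.feature (g z.2.1) z.2.2 c ^ 2)
        (((hzm c).comp measurable_snd).pow_const 2) (hz2 c).integrable_sq)
      (PPI.tendsto_sampleMean_lab_error_sq hvalid hsample hg hd)
  have hdu : Tendsto (fun q : ℕ × Ω => PPI.sampleMean fun i =>
      ((S q.1).fUnl j q.2 i - f ((S q.1).unl j i q.2)) ^ 2) (PPI.inProb Pr) (𝓝 0) := by
    simp only [hfUnl, ← hf_def]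
    exact PPI.tendsto_sampleMean_linPred_sub_sq hb
      (fun c => PPI.tendsto_sampleMean_unl hsample (hN j)
        (h := fun w => PPI.feature (g w.1) w.2 c ^ 2) ((hzm c).pow_const 2)
        (hz2 c).integrable_sq)
      (PPI.tendsto_sampleMean_unl_error_sq hK hvalid hsample hg hd)
  have hdiff : Tendsto (fun q : ℕ × Ω => √((S q.1).n j) *
      ((PPI.sampleMean ((S q.1).fLab j q.2) -
          PPI.sampleMean fun i => f ((S q.1).lab j i q.2).2) -
        (PPI.sampleMean ((S q.1).fUnl j q.2) -
          PPI.sampleMean fun i => f ((S q.1).unl j i q.2)))) (PPI.inProb Pr) (𝓝 0) := by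
    simp only [hfLab, hfUnl, ← hf_def]
    exact PPI.tendsto_mul_sampleMean_linPred_sub hb
      (fun c => PPI.bddAlong_sampleMean_sub hsample hn (hN j) (hnN j)
        (h := fun w => PPI.feature (g w.1) w.2 c) (hzm c) (hz2 c))
      (PPI.tendsto_sqrt_mul_sampleMean_error_sub hK hvalid hsample hg hn (hN j) (hnN j) hd)
  -- consistency of the coefficient
  have hvar_eq : PPI.varControl (P j) f =
      (∫ z, f z.2 ^ 2 ∂(P j)) - (∫ z, f z.2 ∂(P j)) ^ 2 := variance_eq_sub hf2
  have hl_eq : l = ((∫ z, z.1 * f z.2 ∂(P j)) - (∫ z, z.1 ∂(P j)) * ∫ z, f z.2 ∂(P j)) /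
      ((1 + ρ j) * ((∫ z, f z.2 ^ 2 ∂(P j)) - (∫ z, f z.2 ∂(P j)) ^ 2)) := by
    rw [← hl_def, PPI.lambdaStar, covariance_eq_sub (hY j) hf2, hvar_eq]
    rfl
  have hy1 := PPI.tendsto_sampleMean_lab hsample hn (h := fun z => z.1) measurable_fst hYi
  have hy2 := PPI.tendsto_sampleMean_lab hsample hn (h := fun z => z.1 ^ 2)
    (measurable_fst.pow_const 2) (hY j).integrable_sq
  have hf1 := PPI.tendsto_sampleMean_lab hsample hn (h := fun z => f z.2)
    (hfm.comp measurable_snd) hfi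
  have hf2' := PPI.tendsto_sampleMean_lab hsample hn (h := fun z => f z.2 ^ 2)
    ((hfm.comp measurable_snd).pow_const 2) hf2.integrable_sq
  have hyf := PPI.tendsto_sampleMean_lab hsample hn (h := fun z => z.1 * f z.2)
    (measurable_fst.mul (hfm.comp measurable_snd)) ((hY j).integrable_mul hf2)
  have hu1 := PPI.tendsto_sampleMean_unl hsample (hN j) hfm hfi
  have hu2 := PPI.tendsto_sampleMean_unl hsample (hN j) (h := fun w => f w ^ 2)
    (hfm.pow_const 2) hf2.integrable_sq
  have hlam : Tendsto (fun q : ℕ × Ω => PPI.lambdaHat ((S q.1).y j q.2) ((S q.1).fLab j q.2)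
      ((S q.1).fUnl j q.2)) (PPI.inProb Pr) (𝓝 l) := by
    rw [hl_eq]
    exact PPI.tendsto_lambdaHat (n := fun q : ℕ × Ω => (S q.1).n j)
      (N := fun q : ℕ × Ω => (S q.1).N j) (y := fun q => (S q.1).y j q.2)
      (f := fun q => (S q.1).fLab j q.2) (f' := fun q i => f ((S q.1).lab j i q.2).2)
      (u := fun q => (S q.1).fUnl j q.2) (u' := fun q i => f ((S q.1).unl j i q.2))
      (hρ j) (hn.comp PPI.tendsto_fst_inProb) ((hN j).comp PPI.tendsto_fst_inProb)
      ((hnN j).comp PPI.tendsto_fst_inProb) hy1 hy2 hf1 hf2' hyf hu1 hu2 hdf hdu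
      (hvar_eq ▸ hvar)
  -- equivalence with the oracle
  have horacle := PPI.tendsto_mul_ppiPlusPlus_sub (n := fun q : ℕ × Ω => (S q.1).n j)
    (N := fun q : ℕ × Ω => (S q.1).N j) (y := fun q => (S q.1).y j q.2)
    (f := fun q => (S q.1).fLab j q.2) (f' := fun q i => f ((S q.1).lab j i q.2).2)
    (u := fun q => (S q.1).fUnl j q.2) (u' := fun q i => f ((S q.1).unl j i q.2))
    (s := fun q => √((S q.1).n j)) hlam
    (PPI.bddAlong_sampleMean_sub hsample hn (hN j) (hnN j) hfm hf2) hdiff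
  change Tendsto (fun q : ℕ × Ω => √((S q.1).n j) *
    ((S q.1).estimate j q.2 - (S q.1).oracle f l j q.2)) (PPI.inProb Pr) (𝓝 0) at horacle
  change Tendsto (fun q : ℕ × Ω => (S q.1).lambda j q.2) (PPI.inProb Pr) (𝓝 l) at hlam
  have hlam' := (PPI.tendstoInMeasure_const_iff (X := fun m => (S m).lambda j)).2 hlam
  have horacle' := (PPI.tendstoInMeasure_const_iff
    (X := fun m ω => √((S m).n j) * ((S m).estimate j ω - (S m).oracle f l j ω))).2 horacle
  refine ⟨?_, hlam', horacle'⟩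
  have hlead := PPI.tendstoInDistribution_leading hsample hn (hN j)
    (h := fun z => z.1 - l * f z.2) (measurable_fst.sub ((hfm.comp measurable_snd).const_mul l))
    ((hY j).sub (hf2.const_mul l)) hfm hf2 (l * √(ρ j))
  -- The independent labeled and unlabeled sums contribute one term of the variance each; `√ρ`
  -- squared is `ρ` since `ρ` is positive.
  have hV : variance (fun z => z.1 - l * f z.2) (P j) +
      (l * √(ρ j)) ^ 2 * PPI.varControl (P j) f = PPI.asympVar (P j) f (ρ j) := by
    rw [PPI.asympVar, hl_def, mul_pow, Real.sq_sqrt (hρ j).le]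
    ring
  rw [hV] at hlead
  have hmeas : ∀ m, Measurable fun ω => √((S m).n j) * ((S m).estimate j ω - PPI.theta (P j)) :=
    fun m => (((hsample m).measurable_estimate (hvalid m) j).sub_const _).const_mul _
  -- Estimate minus oracle plus oracle minus leading term: both vanish, so the estimate inherits the
  -- Gaussian limit.
  have hsum := horacle.add
    (PPI.tendsto_oracle_sub_leading hsample hn (hN j) (hnN j) hYi hfm hf2 l)
  rw [add_zero] at hsum
  refine PPI.tendstoInDistribution_of_tendsto_sub hlead hmeas (hsum.congr fun q => ?_)
  ring
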